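/- **Definitions.** A *discrete $n$-box* $\mathcal T=\{G,B_1,\dots,B_n,B_1',\dots,B_n'\}$ consists of a finite simplicial complex $K$ with 1-skeleton $G=(V,E)$ and subcomplexes $B_i,B_i'$ of $K$ such that some homeomorphism from the geometric realization $|K|$ onto $[0,1]^n$ carries $|B_i|$ onto $\{x_i=0\}$ and $|B_i'|$ onto $\{x_i=1\}$ for every $i$; $B_1,B_1'$ are the top and bottom faces. A *metric* is a function $m:V\to[0,\infty)$, its volume is $\|m\|_n=(\sum_{v\in V}m(v)^n)^{1/n}$, and its length $\ell_m$ is the minimum of $\sum_{v\in\gamma}m(v)$ over the vertex paths $\gamma$ in $G$ from a vertex of $B_1$ to a vertex of $B_1'$. The *extremal length* is $\mathrm{EL}(\mathcal T)=\sup\{\ell_m/\|m\|_n : \|m\|_n>0\}$, and a metric $m$ with $\|m\|_n>0$ is *extremal* if it attains this supremum. For a permutation $\sigma$ of $\{1,\dots,n\}$ let $\mathcal T^\sigma=\{G,B_{\sigma(1)},\dots,B_{\sigma(n)},B'_{\sigma(1)},\dots,B'_{\sigma(n)}\}$. Each of $B_i$ and $B_i'$ is itself a discrete $(n-1)$-box,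 whose pairs of opposing faces are its intersections with $B_j$ and with $B_j'$, for $j\ne i$. A *cube tiling* by $\mathcal T$ of $\mathcal U=[0,h_1]\times\cdots\times[0,h_n]$ (all $h_i>0$) is a family of axis-parallel cubes $C_v$, $v\in V$ (side length $0$, i.e. a point, is allowed) with $\bigcup_v C_v=\mathcal U$ such that two cubes of distinct vertices meet at most along their boundaries, $C_v\cap C_w\neq\varnothing$ whenever $v,w$ are adjacent in $G$, and $C_v$ meets $\{x_i=0\}$ whenever $v\in B_i$ and meets $\{x_i=h_i\}$ whenever $v\in B_i'$. **Theorem.** Let $n\ge 3$, let $\mathcal T$ be a discrete $n$-box with extremal metric $m$, and suppose that there is a cube tiling by $\mathcal T$ of a box $\mathcal U=[0,h_1]\times\cdots\times[0,h_n]$ of volume $h_1\cdots h_n=1$. Then: 1. For every $1\le i\le n$, $\mathrm{EL}(B_i)=\mathrm{EL}(B_i')$, where $B_i$ and $B_i'$ are considered as discrete $(n-1)$-boxes whose top and bottom faces are chosen consistently: for any $j\neq i$, the top and bottom faces are $B_i\cap B_j$, $B_i\cap B_j'$ and $B_i'\cap B_j$, $B_i'\cap B_j'$, respectively. 2. If for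 each $i$ a permutation $\sigma_i$ of $\{1,\dots,n\}$ with $\sigma_i(1)=i$ is given and $\mathcal T_i=\mathcal T^{\sigma_i}$, then $\mathrm{EL}(\mathcal T_1)\cdot\mathrm{EL}(\mathcal T_2)\cdots\mathrm{EL}(\mathcal T_n)=1$. 3. There are distinct vertices $v,w$ of $G$ with $m(v)=m(w)>0$. -/

import Mathlib

open scoped NNReal

/-- The geometric realization of a (finite) abstract simplicial complex, in barycentric
coordinates: the points of the simplices spanned by its faces. -/
def realization {V : Type*} (K : PreAbstractSimplicialComplex V) : Set (V → ℝ) :=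
  {x | ∃ s ∈ K.faces, (∀ v, v ∉ s → x v = 0) ∧ (∀ v, 0 ≤ x v) ∧ ∑ v ∈ s, x v = 1}

theorem realization_inf {V : Type*} (K L : PreAbstractSimplicialComplex V) :
    realization (K ⊓ L) = realization K ∩ realization L := by
  classical
  ext x
  constructor
  · rintro ⟨s, hs, hx⟩
    exact ⟨⟨s, hs.1, hx⟩, ⟨s, hs.2, hx⟩⟩
  · rintro ⟨⟨s, hs, hs0, hpos, hs1⟩, ⟨t, ht, ht0, -, -⟩⟩
    have hsum : ∑ v ∈ s ∩ t, x v = 1 := by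
      rw [← hs1]
      apply Finset.sum_subset Finset.inter_subset_left
      intro v hv hvn
      exact ht0 v fun hvt => hvn (Finset.mem_inter.2 ⟨hv, hvt⟩)
    have hne : (s ∩ t).Nonempty := by
      rw [Finset.nonempty_iff_ne_empty]
      intro h0
      rw [h0] at hsum
      simp at hsum
    refine ⟨s ∩ t, ⟨?_, ?_⟩, ?_, hpos, hsum⟩
    · exact (K.isRelLowerSet_faces hs).2 Finset.inter_subset_left hne
    · exact (L.isRelLowerSet_faces ht).2 Finset.inter_subset_right hne
    · intro v hv
      by_cases h : v ∈ s
      · exact ht0 v fun hvt => hv (Finset.mem_inter.2 ⟨h, hvt⟩)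
      · exact hs0 v h

theorem realization_mono {V : Type*} {K L : PreAbstractSimplicialComplex V} (h : K ≤ L) :
    realization K ⊆ realization L := by
  rintro x ⟨s, hs, hx⟩
  exact ⟨s, h hs, hx⟩

/-- A discrete `n`-box: a triangulation `complex` of the `n`-cube together with the
triangulations `B i`, `B' i` of its opposing faces. The homeomorphism of the realization onto
`[0,1]^n` carries (the realizations of) `B i` and `B' i` onto the faces `x i = 0` and `x i = 1`.
Vertices are elements of `V`; not every element of `V` has to be one. -/
structure DiscreteBox (V : Type*) (n : ℕ) where
  complex : PreAbstractSimplicialComplex V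
  B : Fin n → PreAbstractSimplicialComplex V
  B' : Fin n → PreAbstractSimplicialComplex V
  B_le : ∀ i, B i ≤ complex
  B'_le : ∀ i, B' i ≤ complex
  triangulates : ∃ φ : realization complex ≃ₜ Set.Icc (0 : Fin n → ℝ) 1,
    (∀ i (x : realization complex), (x : V → ℝ) ∈ realization (B i) ↔ (φ x : Fin n → ℝ) i = 0) ∧
    (∀ i (x : realization complex), (x : V → ℝ) ∈ realization (B' i) ↔ (φ x : Fin n → ℝ) i = 1)

/-- Permuting coordinates is a homeomorphism of the cube. -/
def cubePermute {n : ℕ} (σ : Equiv.Perm (Fin n)) :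
    Set.Icc (0 : Fin n → ℝ) 1 ≃ₜ Set.Icc (0 : Fin n → ℝ) 1 where
  toFun y := ⟨fun j => y.1 (σ j), fun j => y.2.1 (σ j), fun j => y.2.2 (σ j)⟩
  invFun y := ⟨fun j => y.1 (σ.symm j), fun j => y.2.1 (σ.symm j), fun j => y.2.2 (σ.symm j)⟩
  left_inv y := by ext j; simp
  right_inv y := by ext j; simp
  continuous_toFun := by
    refine Continuous.subtype_mk (continuous_pi fun j => ?_) _
    exact (continuous_apply (σ j)).comp continuous_subtype_val
  continuous_invFun := by
    refine Continuous.subtype_mk (continuous_pi fun j => ?_) _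
    exact (continuous_apply (σ.symm j)).comp continuous_subtype_val

/-- If the face `x i = c` of the `(n+1)`-cube corresponds to the subcomplex `L` of `K`, then
the realization of `L` is homeomorphic to the `n`-cube by deleting the `i`-th coordinate. -/
def faceHomeo {V : Type*} {n : ℕ} {K L : PreAbstractSimplicialComplex V} (hL : L ≤ K)
    (φ : realization K ≃ₜ Set.Icc (0 : Fin (n + 1) → ℝ) 1) (i : Fin (n + 1)) (c : ℝ)
    (hc : c ∈ Set.Icc (0 : ℝ) 1)
    (hφ : ∀ x : realization K, (x : V → ℝ) ∈ realization L ↔ (φ x : Fin (n + 1) → ℝ) i = c) :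
    realization L ≃ₜ Set.Icc (0 : Fin n → ℝ) 1 where
  toFun x := ⟨fun j => (φ ⟨x.1, realization_mono hL x.2⟩).1 (i.succAbove j),
    fun j => (φ ⟨x.1, realization_mono hL x.2⟩).2.1 (i.succAbove j),
    fun j => (φ ⟨x.1, realization_mono hL x.2⟩).2.2 (i.succAbove j)⟩
  invFun y := ⟨(φ.symm ⟨i.insertNth c y.1,
      (Fin.insertNth_mem_Icc (α := fun _ => ℝ)).2 ⟨hc, y.2⟩⟩).1, by
    rw [hφ]; simp⟩
  left_inv x := by
    have h := (hφ ⟨x.1, realization_mono hL x.2⟩).1 x.2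
    apply Subtype.ext
    have : (⟨i.insertNth c fun j => (φ ⟨x.1, realization_mono hL x.2⟩).1 (i.succAbove j),
        (Fin.insertNth_mem_Icc (α := fun _ => ℝ)).2 ⟨hc,
          fun j => (φ ⟨x.1, realization_mono hL x.2⟩).2.1 (i.succAbove j),
          fun j => (φ ⟨x.1, realization_mono hL x.2⟩).2.2 (i.succAbove j)⟩⟩ :
        Set.Icc (0 : Fin (n + 1) → ℝ) 1) = φ ⟨x.1, realization_mono hL x.2⟩ := by
      apply Subtype.ext
      funext k
      rcases Fin.eq_self_or_eq_succAbove i k with rfl | ⟨j, rfl⟩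
      · simpa using h.symm
      · simp
    simp [this]
  right_inv y := by
    ext j
    simp
  continuous_toFun := by
    refine Continuous.subtype_mk (continuous_pi fun j => ?_) _
    exact (continuous_apply (i.succAbove j)).comp (continuous_subtype_val.comp
      (φ.continuous.comp (Continuous.subtype_mk continuous_subtype_val _)))
  continuous_invFun := by
    refine Continuous.subtype_mk ?_ _
    refine continuous_subtype_val.comp (φ.symm.continuous.comp (Continuous.subtype_mk ?_ _))
    exact Continuous.finInsertNth i continuous_const continuous_subtype_val

namespace DiscreteBox

/-- The discrete box with its pairs of opposing faces renumbered by `σ`. -/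
def permute {V : Type*} {n : ℕ} (T : DiscreteBox V n) (σ : Equiv.Perm (Fin n)) :
    DiscreteBox V n where
  complex := T.complex
  B i := T.B (σ i)
  B' i := T.B' (σ i)
  B_le i := T.B_le (σ i)
  B'_le i := T.B'_le (σ i)
  triangulates := by
    obtain ⟨φ, h, h'⟩ := T.triangulates
    exact ⟨φ.trans (cubePermute σ), fun i x => h (σ i) x, fun i x => h' (σ i) x⟩

/-- The face `B i` as a discrete box of one dimension less. Its opposing faces are the
intersections of `B i` with `B j` and `B' j` for the `j ≠ i`, in increasing order of `j`. -/
def face {V : Type*} {n : ℕ} (T : DiscreteBox V (n + 1)) (i : Fin (n + 1)) :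
    DiscreteBox V n where
  complex := T.B i
  B j := T.B i ⊓ T.B (i.succAbove j)
  B' j := T.B i ⊓ T.B' (i.succAbove j)
  B_le _ := Set.inter_subset_left
  B'_le _ := Set.inter_subset_left
  triangulates := by
    obtain ⟨φ, h, h'⟩ := T.triangulates
    refine ⟨faceHomeo (T.B_le i) φ i 0 (by simp) (h i), fun j x => ?_, fun j x => ?_⟩
    · rw [realization_inf]
      exact ⟨fun hx => (h _ ⟨x.1, realization_mono (T.B_le i) x.2⟩).1 hx.2,
        fun hx => ⟨x.2, (h _ ⟨x.1, realization_mono (T.B_le i) x.2⟩).2 hx⟩⟩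
    · rw [realization_inf]
      exact ⟨fun hx => (h' _ ⟨x.1, realization_mono (T.B_le i) x.2⟩).1 hx.2,
        fun hx => ⟨x.2, (h' _ ⟨x.1, realization_mono (T.B_le i) x.2⟩).2 hx⟩⟩

/-- The face `B' i` as a discrete box of one dimension less, its opposing faces numbered
in the same way as those of `B i`. -/
def face' {V : Type*} {n : ℕ} (T : DiscreteBox V (n + 1)) (i : Fin (n + 1)) :
    DiscreteBox V n where
  complex := T.B' i
  B j := T.B' i ⊓ T.B (i.succAbove j)
  B' j := T.B' i ⊓ T.B' (i.succAbove j)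
  B_le _ := Set.inter_subset_left
  B'_le _ := Set.inter_subset_left
  triangulates := by
    obtain ⟨φ, h, h'⟩ := T.triangulates
    refine ⟨faceHomeo (T.B'_le i) φ i 1 (by simp) (h' i), fun j x => ?_, fun j x => ?_⟩
    · rw [realization_inf]
      exact ⟨fun hx => (h _ ⟨x.1, realization_mono (T.B'_le i) x.2⟩).1 hx.2,
        fun hx => ⟨x.2, (h _ ⟨x.1, realization_mono (T.B'_le i) x.2⟩).2 hx⟩⟩
    · rw [realization_inf]
      exact ⟨fun hx => (h' _ ⟨x.1, realization_mono (T.B'_le i) x.2⟩).1 hx.2,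
        fun hx => ⟨x.2, (h' _ ⟨x.1, realization_mono (T.B'_le i) x.2⟩).2 hx⟩⟩

/-- The vertices of the triangulation. -/
abbrev Vertex {V : Type*} {n : ℕ} (T : DiscreteBox V n) : Type _ :=
  {v : V // {v} ∈ T.complex.faces}

noncomputable instance {V : Type*} [Finite V] {n : ℕ} (T : DiscreteBox V n) :
    Fintype T.Vertex := Fintype.ofFinite _

/-- The 1-skeleton of the triangulation. -/
def graph {V : Type*} {n : ℕ} (T : DiscreteBox V n) : SimpleGraph T.Vertex where
  Adj v w := v ≠ w ∧ ∃ s ∈ T.complex.faces, v.1 ∈ s ∧ w.1 ∈ s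
  symm := ⟨fun _ _ h => ⟨h.1.symm, h.2.imp fun _ hs => ⟨hs.1, hs.2.2, hs.2.1⟩⟩⟩
  loopless := ⟨fun _ h => h.1 rfl⟩

/-- The volume `(∑ m(v)^n)^(1/n)` of a metric. -/
noncomputable def volume {V : Type*} [Finite V] {n : ℕ} (T : DiscreteBox V n)
    (m : T.Vertex → ℝ≥0) : ℝ :=
  (∑ v, (m v : ℝ) ^ n) ^ ((1 : ℝ) / n)

/-- The `m`-lengths of the vertex paths from the top face to the bottom face. -/
def pathLengths {V : Type*} {n : ℕ} [NeZero n] (T : DiscreteBox V n)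
    (m : T.Vertex → ℝ≥0) : Set ℝ :=
  {L | ∃ v w : T.Vertex, {v.1} ∈ (T.B 0).faces ∧ {w.1} ∈ (T.B' 0).faces ∧
    ∃ γ : T.graph.Path v w, L = (γ.1.support.map fun u => (m u : ℝ)).sum}

/-- The length of a metric. -/
noncomputable def length {V : Type*} {n : ℕ} [NeZero n] (T : DiscreteBox V n)
    (m : T.Vertex → ℝ≥0) : ℝ :=
  sInf (T.pathLengths m)

/-- The normalized length of a metric. -/
noncomputable def normalizedLength {V : Type*} [Finite V] {n : ℕ} [NeZero n]
    (T : DiscreteBox V n) (m : T.Vertex → ℝ≥0) : ℝ :=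
  T.length m / T.volume m

/-- The extremal length of a discrete box: the supremum of the normalized lengths of
the metrics of positive volume. -/
noncomputable def EL {V : Type*} [Finite V] {n : ℕ} [NeZero n] (T : DiscreteBox V n) : ℝ :=
  sSup (T.normalizedLength '' {m | 0 < T.volume m})

/-- A metric is extremal if it has positive volume and realizes the extremal length. -/
def IsExtremal {V : Type*} [Finite V] {n : ℕ} [NeZero n] (T : DiscreteBox V n)
    (m : T.Vertex → ℝ≥0) : Prop :=
  0 < T.volume m ∧ T.normalizedLength m = T.EL

end DiscreteBox

/-- The axis-parallel cube with lowest corner `a` and side length `r`;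
for `r = 0` it is the point `a`. -/
def axisCube {n : ℕ} (a : Fin n → ℝ) (r : ℝ≥0) : Set (Fin n → ℝ) :=
  Set.Icc a (fun i => a i + r)

/-- A cube tiling of the geometric box `[0, h 0] × ⋯ × [0, h (n-1)]` by the discrete box `T`:
the cubes cover the box and nothing else, meet one another only along their boundaries,
adjacent vertices have intersecting cubes, and the cubes of the vertices of `B i` and of `B' i`
meet the faces `x i = 0` and `x i = h i` of the geometric box. Null-weight vertices
(cubes that are single points) are allowed. -/
structure CubeTiling {V : Type*} {n : ℕ} (T : DiscreteBox V n) (h : Fin n → ℝ) where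
  corner : T.Vertex → Fin n → ℝ
  side : T.Vertex → ℝ≥0
  cover : ⋃ v, axisCube (corner v) (side v) = Set.Icc 0 h
  inter_subset : ∀ v w, v ≠ w → axisCube (corner v) (side v) ∩ axisCube (corner w) (side w) ⊆
    frontier (axisCube (corner v) (side v)) ∩ frontier (axisCube (corner w) (side w))
  adj : ∀ v w, T.graph.Adj v w →
    (axisCube (corner v) (side v) ∩ axisCube (corner w) (side w)).Nonempty
  meets : ∀ i (v : T.Vertex), {v.1} ∈ (T.B i).faces →
    ∃ x ∈ axisCube (corner v) (side v), x i = 0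
  meets' : ∀ i (v : T.Vertex), {v.1} ∈ (T.B' i).faces →
    ∃ x ∈ axisCube (corner v) (side v), x i = h i

/-! A line through the box, parallel to a coordinate axis, meets the cubes of a chain of neighbours
from one face of the discrete box to the opposite one. To see this, label each vertex in each of the
other directions by the side (`-1`, `0` or `1`) of the line on which its cube lies. If no such chain
existed, the set reachable from one face along cubes that meet the line would provide labels in the
remaining direction too, and the linear extension of the labels would be a map of the cube without
zeros, against the Poincaré–Miranda theorem.

Integrating the length of this chain over all lines bounds the length of a metric `m` times the area
of the face by `∑ m(v) s(v) ^ (n - 1)`, where `s(v)` is the side of the cube of `v`. Hölder's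
inequality turns this into `EL = h₁ / (∏ hᵢ) ^ (1 / n)`, and its equality case shows that the
extremal metrics are the multiples of `s`. The formula applies to every direction, and to the
packings of two opposite faces by the faces of the cubes that touch them.

Finally, a box of dimension at least three has no tiling by cubes of distinct sizes: the smallest
cube standing on a floor that is walled in by higher cubes is surrounded by larger cubes, so that
its top is again such a floor, and this would go on forever. -/

/-! ### The Poincaré–Miranda theorem -/

section ModTwoDegree

variable {R X : Type*} [CommRing R]

/-- The cup product `δ(u 0) ∪ ⋯ ∪ δ(u (n - 1))` of coboundaries of functions, evaluated on the
`n`-simplex with the ordered vertices `p 0, …, p n`. -/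
def cupCoboundary {n : ℕ} (u : Fin n → X → R) (p : ℕ → X) : R :=
  ∏ j : Fin n, (u j (p (j + 1)) - u j (p j))

/-- The cup product `u 0 ∪ δ(u 1) ∪ ⋯ ∪ δ(u n)`, evaluated on the `n`-simplex `p 0, …, p n`. It is
a primitive of `cupCoboundary u`. -/
def cupPrimitive {n : ℕ} (u : Fin (n + 1) → X → R) (p : ℕ → X) : R :=
  u 0 (p 0) * cupCoboundary (fun j => u j.succ) p

/-- The facet of the simplex `p 0, p 1, …` opposite to its vertex `p i`. -/
def dropVertex (i : ℕ) (p : ℕ → X) (t : ℕ) : X :=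
  if t < i then p t else p (t + 1)

theorem cupCoboundary_congr {n : ℕ} (u : Fin n → X → R) {p q : ℕ → X} (h : ∀ t ≤ n, p t = q t) :
    cupCoboundary u p = cupCoboundary u q :=
  Finset.prod_congr rfl fun j _ => by rw [h _ j.2, h _ j.2.le]

theorem cupPrimitive_congr {n : ℕ} (u : Fin (n + 1) → X → R) {p q : ℕ → X}
    (h : ∀ t ≤ n, p t = q t) : cupPrimitive u p = cupPrimitive u q := by
  rw [cupPrimitive, cupPrimitive, cupCoboundary_congr _ h, h 0 (Nat.zero_le n)]

theorem cupCoboundary_castSucc {n : ℕ} (u : Fin (n + 1) → X → R) (p : ℕ → X) :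
    cupCoboundary u p =
      cupCoboundary (fun j => u j.castSucc) p *
        (u (Fin.last n) (p (n + 1)) - u (Fin.last n) (p n)) :=
  Fin.prod_univ_castSucc _

theorem cupPrimitive_castSucc {n : ℕ} (u : Fin (n + 2) → X → R) (p : ℕ → X) :
    cupPrimitive u p = cupPrimitive (fun j => u j.castSucc) p *
      (u (Fin.last (n + 1)) (p (n + 1)) - u (Fin.last (n + 1)) (p n)) := by
  rw [cupPrimitive, cupCoboundary_castSucc, ← mul_assoc]
  rfl

theorem sum_cupPrimitive_dropVertex [CharP R 2] {n : ℕ} (u : Fin (n + 1) → X → R) (p : ℕ → X) :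
    ∑ i ∈ Finset.range (n + 2), cupPrimitive u (dropVertex i p) = cupCoboundary u p := by
  induction n with
  | zero =>
    simp [Finset.sum_range_succ, cupPrimitive, cupCoboundary, dropVertex, CharTwo.sub_eq_add]
  | succ n ih =>
    have drop_end : ∀ i, n < i → cupPrimitive (fun j => u j.castSucc) (dropVertex i p) =
        cupPrimitive (fun j => u j.castSucc) p := fun i hi =>
      cupPrimitive_congr _ fun t ht => if_pos (ht.trans_lt hi)
    have last_factor : ∀ i ∈ Finset.range (n + 1),
        u (Fin.last (n + 1)) (dropVertex i p (n + 1)) - u (Fin.last (n + 1)) (dropVertex i p n) =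
          u (Fin.last (n + 1)) (p (n + 2)) - u (Fin.last (n + 1)) (p (n + 1)) := fun i hi => by
      have := Finset.mem_range.1 hi
      rw [dropVertex, dropVertex, if_neg (by omega), if_neg (by omega)]
    rw [cupCoboundary_castSucc, ← ih, Finset.sum_range_succ, Finset.sum_range_succ,
      Finset.sum_range_succ _ (n + 1), add_mul, Finset.sum_mul]
    simp only [cupPrimitive_castSucc u]
    rw [Finset.sum_congr rfl fun i hi => by rw [last_factor i hi],
      drop_end (n + 1) (by omega), drop_end (n + 2) (by omega)]
    simp only [dropVertex, lt_add_iff_pos_right, Nat.lt_add_one, if_true, lt_irrefl, if_false,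
      Order.lt_two_iff, zero_le_one]
    linear_combination -(cupPrimitive (fun j => u j.castSucc) p *
      (u (Fin.last (n + 1)) (p n) - u (Fin.last (n + 1)) (p (n + 1)))) *
      (CharTwo.two_eq_zero : (2 : R) = 0)

/-- The `t`-th vertex of the monotone lattice path from `z` that performs the unit step in the
`i`-th coordinate at time `ρ i`. For fixed `z` and varying `ρ` these are the simplices of Kuhn's
triangulation of the unit cube at `z`. -/
def latticePath {n : ℕ} (ρ : Equiv.Perm (Fin n)) (z : Fin n → ℕ) (t : ℕ) : Fin n → ℕ :=
  fun i => z i + if (ρ i : ℕ) < t then 1 else 0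

theorem latticePath_mem_Icc {n : ℕ} (ρ : Equiv.Perm (Fin n)) (z : Fin n → ℕ) (t : ℕ) :
    latticePath ρ z t ∈ Set.Icc z (z + 1) := by
  refine ⟨fun i => ?_, fun i => ?_⟩ <;> simp only [latticePath, Pi.add_apply, Pi.one_apply] <;>
    split_ifs <;> omega

theorem latticePath_swap {n : ℕ} (ρ : Equiv.Perm (Fin (n + 1))) (z : Fin (n + 1) → ℕ) (k : Fin n)
    {t : ℕ} (ht : t ≠ k + 1) :
    latticePath (Equiv.swap k.castSucc k.succ * ρ) z t = latticePath ρ z t := by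
  funext i
  have : ((Equiv.swap k.castSucc k.succ (ρ i) : Fin (n + 1)) : ℕ) < t ↔ (ρ i : ℕ) < t := by
    rw [Equiv.swap_apply_def]
    split_ifs with h h' <;> simp only [*, Fin.val_succ, Fin.val_castSucc] <;> omega
  simp only [latticePath, Equiv.Perm.mul_apply, this]

theorem sum_perm_eq_zero_of_swap [CharP R 2] {n : ℕ} (k : Fin n)
    (E : Equiv.Perm (Fin (n + 1)) → R)
    (hE : ∀ ρ, E (Equiv.swap k.castSucc k.succ * ρ) = E ρ) : ∑ ρ, E ρ = 0 := by
  refine Finset.sum_involution (fun ρ _ => Equiv.swap k.castSucc k.succ * ρ) ?_ ?_ ?_ ?_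
  · intro ρ _
    rw [hE, CharTwo.add_self_eq_zero]
  · intro ρ _ _ h
    rw [mul_eq_right, Equiv.swap_eq_one_iff] at h
    exact (Fin.castSucc_lt_succ).ne h
  · exact fun _ _ => Finset.mem_univ _
  · intro ρ _
    rw [← mul_assoc, Equiv.swap_mul_self, one_mul]

theorem latticePath_succ_eq_rotate {n : ℕ} (ρ : Equiv.Perm (Fin (n + 1))) (z : Fin (n + 1) → ℕ)
    {t : ℕ} (ht : t ≤ n) :
    latticePath ρ z (t + 1) =
      latticePath ((finRotate (n + 1)).symm * ρ) (z + Pi.single (ρ.symm 0) 1) t := by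
  funext i
  simp only [latticePath, Pi.add_apply, Equiv.Perm.mul_apply]
  rcases eq_or_ne (ρ i) 0 with h | h
  · have hlast : (finRotate (n + 1)).symm 0 = Fin.last n := by
      rw [Equiv.symm_apply_eq, finRotate_last]
    have hi : i = ρ.symm 0 := by rw [← h, Equiv.symm_apply_apply]
    simp [h, hlast, ← hi, ht]
  · have hi : i ≠ ρ.symm 0 := fun hi => h (by rw [hi, Equiv.apply_symm_apply])
    have hpos : 0 < (ρ i : ℕ) := Fin.pos_iff_ne_zero.2 h
    have hlt : (ρ i : ℕ) < t + 1 ↔ (ρ i : ℕ) - 1 < t := by omega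
    simp only [coe_finRotate_symm_of_ne_zero h, Pi.single_eq_of_ne hi, add_zero, hlt]

theorem sum_cupCoboundary_latticePath [CharP R 2] {n : ℕ}
    (u : Fin (n + 1) → (Fin (n + 1) → ℕ) → R) (z : Fin (n + 1) → ℕ) :
    ∑ ρ, cupCoboundary u (latticePath ρ z) =
      ∑ ρ, (cupPrimitive u
          (latticePath ((finRotate (n + 1)).symm * ρ) (z + Pi.single (ρ.symm 0) 1)) -
        cupPrimitive u (latticePath ((finRotate (n + 1)).symm * ρ) z)) := by
  have interior : ∀ k ∈ Finset.range n,
      ∑ ρ, cupPrimitive u (dropVertex (k + 1) (latticePath ρ z)) = 0 := by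
    intro k hk
    refine sum_perm_eq_zero_of_swap ⟨k, Finset.mem_range.1 hk⟩ _ fun ρ => ?_
    refine congrArg (cupPrimitive u) (funext fun t => ?_)
    unfold dropVertex
    split_ifs
    · exact latticePath_swap ρ z _ (by dsimp only; omega)
    · exact latticePath_swap ρ z _ (by dsimp only; omega)
  have first : ∀ ρ, cupPrimitive u (dropVertex 0 (latticePath ρ z)) = cupPrimitive u
      (latticePath ((finRotate (n + 1)).symm * ρ) (z + Pi.single (ρ.symm 0) 1)) := fun ρ =>
    cupPrimitive_congr u fun t ht => latticePath_succ_eq_rotate ρ z ht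
  have last : ∀ ρ, cupPrimitive u (dropVertex (n + 1) (latticePath ρ z)) =
      cupPrimitive u (latticePath ρ z) := fun ρ =>
    cupPrimitive_congr u fun t ht => if_pos (by omega)
  simp only [← sum_cupPrimitive_dropVertex]
  rw [Finset.sum_comm, Finset.sum_range_succ, Finset.sum_range_succ',
    Finset.sum_eq_zero interior, zero_add]
  simp only [first, last]
  rw [Finset.sum_sub_distrib, CharTwo.sub_eq_add,
    ← Equiv.sum_comp (Equiv.mulLeft (finRotate (n + 1)).symm) fun ρ =>
      cupPrimitive u (latticePath ρ z)]
  rfl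

theorem sum_grid_sub_eq {M : Type*} [AddCommGroup M] {n k : ℕ} (c : Fin (n + 1))
    (G : (Fin (n + 1) → ℕ) → M) :
    ∑ z : Fin (n + 1) → Fin k,
        (G ((fun i => (z i : ℕ)) + Pi.single c 1) - G (fun i => (z i : ℕ))) =
      ∑ w : Fin n → Fin k, (G (c.insertNth (α := fun _ => ℕ) k fun i => (w i : ℕ)) -
        G (c.insertNth (α := fun _ => ℕ) 0 fun i => (w i : ℕ))) := by
  rw [← (Fin.insertNthEquiv (fun _ => Fin k) c).sum_comp, Fintype.sum_prod_type_right]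
  refine Finset.sum_congr rfl fun w _ => ?_
  let line (a : ℕ) : Fin (n + 1) → ℕ := c.insertNth (α := fun _ => ℕ) a fun i => (w i : ℕ)
  have point : ∀ a : Fin k,
      (fun i => (Fin.insertNthEquiv (fun _ => Fin k) c (a, w) i : ℕ)) = line a := fun a => by
    funext i
    rcases Fin.eq_self_or_eq_succAbove c i with rfl | ⟨j, rfl⟩ <;> simp [line]
  have next : ∀ a : ℕ, line a + Pi.single c 1 = line (a + 1) := fun a => by
    funext i
    rcases Fin.eq_self_or_eq_succAbove c i with rfl | ⟨j, rfl⟩ <;> simp [line]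
  simp only [point, next]
  rw [Fin.sum_univ_eq_sum_range (fun a => G (line (a + 1)) - G (line a)),
    Finset.sum_range_sub fun a => G (line a)]

theorem latticePath_rotate_apply {n : ℕ} (ρ : Equiv.Perm (Fin (n + 1))) (z : Fin (n + 1) → ℕ)
    {c : Fin (n + 1)} (hc : ρ c = 0) {t : ℕ} (ht : t ≤ n) :
    latticePath ((finRotate (n + 1)).symm * ρ) z t c = z c := by
  have hlast : (finRotate (n + 1)).symm 0 = Fin.last n := by
    rw [Equiv.symm_apply_eq, finRotate_last]
  simp [latticePath, hc, hlast, ht]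

theorem latticePath_rotate_decomposeFin {n : ℕ} (e : Equiv.Perm (Fin n)) (a : ℕ) (w : Fin n → ℕ)
    {t : ℕ} (ht : t ≤ n) :
    latticePath ((finRotate (n + 1)).symm * Equiv.Perm.decomposeFin.symm (0, e))
      (Fin.cons a w : Fin (n + 1) → ℕ) t = (Fin.cons a (latticePath e w t) : Fin (n + 1) → ℕ) := by
  funext i
  induction i using Fin.cases with
  | zero => exact latticePath_rotate_apply _ _ (by simp) ht
  | succ i =>
    have hrot : (((finRotate (n + 1)).symm (e i).succ : Fin (n + 1)) : ℕ) = e i := by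
      rw [coe_finRotate_symm_of_ne_zero (Fin.succ_ne_zero _), Fin.val_succ, Nat.add_sub_cancel]
    simp [latticePath, hrot, -finRotate_symm_apply]

theorem cupPrimitive_latticePath_cons {n : ℕ} (u : Fin (n + 1) → (Fin (n + 1) → ℕ) → R)
    (e : Equiv.Perm (Fin n)) (a : ℕ) (w : Fin n → ℕ) :
    cupPrimitive u
        (latticePath ((finRotate (n + 1)).symm * Equiv.Perm.decomposeFin.symm (0, e))
          (Fin.cons a w : Fin (n + 1) → ℕ)) =
      u 0 (Fin.cons a w : Fin (n + 1) → ℕ) *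
        cupCoboundary (fun j v => u j.succ (Fin.cons a v : Fin (n + 1) → ℕ)) (latticePath e w) := by
  have start : latticePath e w 0 = w := funext fun i => by simp [latticePath]
  rw [cupPrimitive_congr u fun t ht => latticePath_rotate_decomposeFin e a w ht, cupPrimitive,
    start]
  rfl

theorem cupPrimitive_latticePath_eq_zero {n : ℕ} (u : Fin (n + 1) → (Fin (n + 1) → ℕ) → R)
    {ρ : Equiv.Perm (Fin (n + 1))} {c : Fin n} (hc : ρ c.succ = 0) {z : Fin (n + 1) → ℕ} {b : R}
    (hu : ∀ v, v c.succ = z c.succ → u c.succ v = b) :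
    cupPrimitive u (latticePath ((finRotate (n + 1)).symm * ρ) z) = 0 := by
  rw [cupPrimitive, cupCoboundary, Finset.prod_eq_zero (Finset.mem_univ c), mul_zero]
  rw [hu _ (latticePath_rotate_apply ρ z hc c.2), hu _ (latticePath_rotate_apply ρ z hc c.2.le),
    sub_self]

theorem sum_cupCoboundary_eq_one [CharP R 2] (n k : ℕ) (u : Fin n → (Fin n → ℕ) → R)
    (h0 : ∀ j z, z j = 0 → u j z = 0) (h1 : ∀ j z, z j = k → u j z = 1) :
    ∑ z : Fin n → Fin k, ∑ ρ, cupCoboundary u (latticePath ρ fun i => (z i : ℕ)) = 1 := by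
  induction n with
  | zero => simp [cupCoboundary]
  | succ n ih =>
    have facets (ρ : Equiv.Perm (Fin (n + 1))) := sum_grid_sub_eq (k := k) (ρ.symm 0) fun z =>
      cupPrimitive u (latticePath ((finRotate (n + 1)).symm * ρ) z)
    simp only [sum_cupCoboundary_latticePath]
    rw [Finset.sum_comm]
    simp only [facets]
    rw [← Equiv.Perm.decomposeFin.symm.sum_comp, Fintype.sum_prod_type,
      Finset.sum_eq_single (0 : Fin (n + 1)) _ (by simp)]
    · rw [← ih (fun j w => u j.succ (Fin.cons k w)) (fun j w hw => h0 _ _ (by simpa using hw))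
        (fun j w hw => h1 _ _ (by simpa using hw)), Finset.sum_comm]
      refine Finset.sum_congr rfl fun w _ => Finset.sum_congr rfl fun e _ => ?_
      have hc : (Equiv.Perm.decomposeFin.symm ((0 : Fin (n + 1)), e)).symm 0 = 0 := by
        rw [Equiv.symm_apply_eq, Equiv.Perm.decomposeFin_symm_apply_zero]
      rw [hc, Fin.insertNth_zero', Fin.insertNth_zero', cupPrimitive_latticePath_cons,
        cupPrimitive_latticePath_cons, h1 0 _ (Fin.cons_zero _ _), h0 0 _ (Fin.cons_zero _ _),
        one_mul, zero_mul, sub_zero]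
    · intro b _ hb
      refine Finset.sum_eq_zero fun e _ => Finset.sum_eq_zero fun w _ => ?_
      set ρ := Equiv.Perm.decomposeFin.symm (b, e) with hρ
      have hρ0 : ρ.symm 0 ≠ 0 := fun h => hb <| by
        rw [← Equiv.Perm.decomposeFin_symm_apply_zero b e, ← hρ, ← h, Equiv.apply_symm_apply, h]
      obtain ⟨c, hc⟩ := Fin.exists_succ_eq.2 hρ0
      have hρc : ρ c.succ = 0 := by rw [hc, Equiv.apply_symm_apply]
      rw [← hc,
        cupPrimitive_latticePath_eq_zero u hρc (b := 1) fun v hv => h1 _ _ (by simpa using hv),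
        cupPrimitive_latticePath_eq_zero u hρc (b := 0) fun v hv => h0 _ _ (by simpa using hv),
        sub_zero]

theorem exists_cell_forall_exists_notMem_mem {n k : ℕ} (S : Fin n → Set (Fin n → ℕ))
    (h0 : ∀ j z, z j = 0 → z ∉ S j) (h1 : ∀ j z, z j = k → z ∈ S j) :
    ∃ z : Fin n → ℕ, (∀ i, z i < k) ∧
      ∀ j, ∃ a ∈ Set.Icc z (z + 1), ∃ b ∈ Set.Icc z (z + 1), a ∉ S j ∧ b ∈ S j := by
  classical
  let u (j : Fin n) (z : Fin n → ℕ) : ZMod 2 := if z ∈ S j then 1 else 0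
  obtain ⟨z, -, hz⟩ := Finset.exists_ne_zero_of_sum_ne_zero
    ((sum_cupCoboundary_eq_one n k u (fun j z hz => if_neg (h0 j z hz))
      (fun j z hz => if_pos (h1 j z hz))).trans_ne one_ne_zero)
  obtain ⟨ρ, -, hρ⟩ := Finset.exists_ne_zero_of_sum_ne_zero hz
  refine ⟨fun i => z i, fun i => (z i).2, fun j => ?_⟩
  have hne := Finset.prod_ne_zero_iff.1 hρ j (Finset.mem_univ j)
  have hmem := latticePath_mem_Icc ρ fun i => (z i : ℕ)
  by_cases hj : latticePath ρ (fun i => (z i : ℕ)) j ∈ S j <;>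
    by_cases hj' : latticePath ρ (fun i => (z i : ℕ)) (j + 1) ∈ S j
  · simp [u, hj, hj'] at hne
  · exact ⟨_, hmem _, _, hmem _, hj', hj⟩
  · exact ⟨_, hmem _, _, hmem _, hj, hj'⟩
  · simp [u, hj, hj'] at hne

end ModTwoDegree

theorem dist_gridPoint_le {n k : ℕ} {z a : Fin n → ℕ} (ha : a ∈ Set.Icc z (z + 1)) :
    dist (fun i => (a i : ℝ) / (k + 1)) (fun i => (z i : ℝ) / (k + 1)) ≤ 1 / (k + 1) := by
  rw [dist_pi_le_iff (by positivity)]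
  intro i
  have hzi : (z i : ℝ) ≤ a i := by exact_mod_cast ha.1 i
  have hai : (a i : ℝ) ≤ z i + 1 := by exact_mod_cast ha.2 i
  rw [Real.dist_eq, ← sub_div, abs_of_nonneg (div_nonneg (by linarith) (by positivity))]
  gcongr
  linarith

theorem exists_norm_le_of_sign_on_faces {n : ℕ} {F : Set.Icc (0 : Fin n → ℝ) 1 → Fin n → ℝ}
    (hF : Continuous F) (h0 : ∀ x j, x.1 j = 0 → F x j ≤ 0) (h1 : ∀ x j, x.1 j = 1 → 0 ≤ F x j)
    {ε : ℝ} (hε : 0 < ε) : ∃ x, ‖F x‖ ≤ ε := by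
  obtain ⟨δ, hδ, hFδ⟩ := Metric.uniformContinuous_iff.1
    (CompactSpace.uniformContinuous_of_continuous hF) ε hε
  obtain ⟨k, hk⟩ := exists_nat_one_div_lt hδ
  have hk0 : (0 : ℝ) < k + 1 := by positivity
  let pt (z : Fin n → ℕ) (i : Fin n) : ℝ := z i / (k + 1)
  have pt_mem : ∀ z : Fin n → ℕ, (∀ i, z i ≤ k + 1) → pt z ∈ Set.Icc (0 : Fin n → ℝ) 1 :=
    fun z hz => ⟨fun i => by simp only [pt, Pi.zero_apply]; positivity,
      fun i => (div_le_one hk0).2 (by exact_mod_cast hz i)⟩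
  obtain ⟨z, hzk, hz⟩ := exists_cell_forall_exists_notMem_mem (k := k + 1)
    (fun j => {z | z j = k + 1 ∨ z j ≠ 0 ∧ ∃ h, 0 < F ⟨pt z, h⟩ j})
    (by simp +contextual) (by simp +contextual)
  have mem_of_cell : ∀ a ∈ Set.Icc z (z + 1), pt a ∈ Set.Icc (0 : Fin n → ℝ) 1 := fun a ha =>
    pt_mem a fun i => (ha.2 i).trans (hzk i)
  have close : ∀ a (ha : a ∈ Set.Icc z (z + 1)) j,
      |F ⟨pt a, mem_of_cell a ha⟩ j - F ⟨pt z, pt_mem z fun i => (hzk i).le⟩ j| < ε := by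
    intro a ha j
    rw [← Real.dist_eq]
    exact (dist_le_pi_dist _ _ j).trans_lt (hFδ ((dist_gridPoint_le ha).trans_lt hk))
  refine ⟨⟨pt z, pt_mem z fun i => (hzk i).le⟩, (pi_norm_le_iff_of_nonneg hε.le).2 fun j => ?_⟩
  obtain ⟨a, ha, b, hb, haS, hbS⟩ := hz j
  have ha' := close a ha j
  have hb' := close b hb j
  have hFa : F ⟨pt a, mem_of_cell a ha⟩ j ≤ 0 := by
    rcases eq_or_ne (a j) 0 with h | h
    · exact h0 _ j (by simp [pt, h])
    · by_contra! hpos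
      exact haS (Or.inr ⟨h, _, hpos⟩)
  have hFb : 0 ≤ F ⟨pt b, mem_of_cell b hb⟩ j := by
    rcases hbS with h | ⟨-, _, h⟩
    · exact h1 _ j (by simp [pt, h, hk0.ne'])
    · exact h.le
  rw [Real.norm_eq_abs, abs_le]
  rw [abs_lt] at ha' hb'
  constructor <;> linarith

theorem poincare_miranda {n : ℕ} {F : Set.Icc (0 : Fin n → ℝ) 1 → Fin n → ℝ}
    (hF : Continuous F) (h0 : ∀ x j, x.1 j = 0 → F x j ≤ 0) (h1 : ∀ x j, x.1 j = 1 → 0 ≤ F x j) :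
    ∃ x, F x = 0 := by
  have : Nonempty (Set.Icc (0 : Fin n → ℝ) 1) := ⟨0, Set.left_mem_Icc.2 zero_le_one⟩
  obtain ⟨x, -, hx⟩ := isCompact_univ.exists_isMinOn Set.univ_nonempty hF.norm.continuousOn
  refine ⟨x, norm_le_zero_iff.1 (le_of_forall_pos_le_add fun ε hε => ?_)⟩
  obtain ⟨y, hy⟩ := exists_norm_le_of_sign_on_faces hF h0 h1 hε
  rw [zero_add]
  exact (hx (Set.mem_univ y)).trans hy

/-! ### Vertex paths between opposite faces -/

namespace DiscreteBox

variable {V : Type*} {n : ℕ}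

theorem singleton_mem_faces {K : PreAbstractSimplicialComplex V} {s : Finset V} (hs : s ∈ K.faces)
    {v : V} (hv : v ∈ s) : {v} ∈ K.faces :=
  (K.isRelLowerSet_faces hs).2 (Finset.singleton_subset_iff.2 hv) (Finset.singleton_nonempty v)

theorem notMem_B'_of_mem_B (T : DiscreteBox V n) {i : Fin n} {v : V} (hv : {v} ∈ (T.B i).faces) :
    {v} ∉ (T.B' i).faces := by
  classical
  intro hv'
  obtain ⟨φ, hB, hB'⟩ := T.triangulates
  have single_mem : ∀ K : PreAbstractSimplicialComplex V, {v} ∈ K.faces →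
      (Pi.single v 1 : V → ℝ) ∈ realization K := fun K hK =>
    ⟨{v}, hK, fun w hw => Pi.single_eq_of_ne (by simpa using hw) _,
      (Pi.single_nonneg.2 zero_le_one : (0 : V → ℝ) ≤ Pi.single v 1), by simp⟩
  let x : realization T.complex := ⟨Pi.single v 1, single_mem _ (T.B_le i hv)⟩
  exact zero_ne_one (((hB i x).1 (single_mem _ hv)).symm.trans ((hB' i x).1 (single_mem _ hv')))

theorem sum_mul_nonneg_of_mem_realization [Finite V] (T : DiscreteBox V n)
    {K : PreAbstractSimplicialComplex V} {x : V → ℝ} (hx : x ∈ realization K)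
    {a : T.Vertex → ℝ} (ha : ∀ v : T.Vertex, {v.1} ∈ K.faces → 0 ≤ a v) :
    0 ≤ ∑ v, a v * x v.1 := by
  obtain ⟨s, hs, hs0, hx0, -⟩ := hx
  refine Finset.sum_nonneg fun v _ => ?_
  by_cases hv : v.1 ∈ s
  · exact mul_nonneg (ha v (singleton_mem_faces hs hv)) (hx0 _)
  · rw [hs0 _ hv, mul_zero]

theorem exists_vertex_labels_eq_zero [Finite V] (T : DiscreteBox V n)
    (lam : Fin n → T.Vertex → ℝ)
    (h0 : ∀ i (v : T.Vertex), {v.1} ∈ (T.B i).faces → lam i v ≤ 0)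
    (h1 : ∀ i (v : T.Vertex), {v.1} ∈ (T.B' i).faces → 0 ≤ lam i v)
    (hadj : ∀ i v w, T.graph.Adj v w → 0 ≤ lam i v * lam i w) :
    ∃ v, ∀ i, lam i v = 0 := by
  obtain ⟨φ, hB, hB'⟩ := T.triangulates
  have continuous_extension : Continuous fun (y : Set.Icc (0 : Fin n → ℝ) 1) j =>
      ∑ v, lam j v * (φ.symm y).1 v.1 :=
    continuous_pi fun j => continuous_finsetSum _ fun v _ => continuous_const.mul
      ((continuous_apply v.1).comp (continuous_subtype_val.comp φ.symm.continuous))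
  obtain ⟨y, hy⟩ := poincare_miranda continuous_extension
    (fun y j hyj => by
      have := T.sum_mul_nonneg_of_mem_realization ((hB j (φ.symm y)).2 (by simpa using hyj))
        (a := fun v => -lam j v) fun v hv => neg_nonneg.2 (h0 j v hv)
      simpa only [neg_mul, Finset.sum_neg_distrib, neg_nonneg] using this)
    (fun y j hyj =>
      T.sum_mul_nonneg_of_mem_realization ((hB' j (φ.symm y)).2 (by simpa using hyj)) (h1 j))
  obtain ⟨s, hs, hs0, hx0, hs1⟩ := (φ.symm y).2
  obtain ⟨v, hvs, hv⟩ := Finset.exists_ne_zero_of_sum_ne_zero (hs1.trans_ne one_ne_zero)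
  let v' : T.Vertex := ⟨v, singleton_mem_faces hs hvs⟩
  refine ⟨v', fun j => ?_⟩
  have term_nonneg : ∀ w : T.Vertex, 0 ≤ lam j v' * (lam j w * (φ.symm y).1 w.1) := by
    intro w
    by_cases hw : w.1 ∈ s
    · rw [← mul_assoc]
      refine mul_nonneg ?_ (hx0 _)
      rcases eq_or_ne v' w with rfl | hne
      · exact mul_self_nonneg _
      · exact hadj j _ _ ⟨hne, s, hs, hvs, hw⟩
    · rw [hs0 _ hw, mul_zero, mul_zero]
  have sum_eq_zero : ∑ w : T.Vertex, lam j v' * (lam j w * (φ.symm y).1 w.1) = 0 := by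
    rw [← Finset.mul_sum, congrFun hy j, Pi.zero_apply, mul_zero]
  have := (Finset.sum_eq_zero_iff_of_nonneg fun w _ => term_nonneg w).1 sum_eq_zero v'
    (Finset.mem_univ _)
  simpa [v', hv] using this

/-- `w` can be reached from the face `B i` by a vertex path inside `A`. -/
def ReachableIn (T : DiscreteBox V n) (i : Fin n) (A : Set T.Vertex) (w : T.Vertex) : Prop :=
  ∃ v : T.Vertex, {v.1} ∈ (T.B i).faces ∧ ∃ p : T.graph.Walk v w, ∀ u ∈ p.support, u ∈ A

theorem ReachableIn.of_adj {T : DiscreteBox V n} {i : Fin n} {A : Set T.Vertex} {v w : T.Vertex}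
    (hv : T.ReachableIn i A v) (h : T.graph.Adj v w) (hw : w ∈ A) : T.ReachableIn i A w := by
  obtain ⟨a, ha, p, hp⟩ := hv
  refine ⟨a, ha, p.concat h, fun u hu => ?_⟩
  rw [SimpleGraph.Walk.support_concat, List.mem_append, List.mem_singleton] at hu
  rcases hu with hu | rfl
  exacts [hp u hu, hw]

theorem exists_reachableIn_of_labels [Finite V] (T : DiscreteBox V n) (i : Fin n)
    (lam : Fin n → T.Vertex → ℝ)
    (h0 : ∀ j ≠ i, ∀ v : T.Vertex, {v.1} ∈ (T.B j).faces → lam j v ≤ 0)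
    (h1 : ∀ j ≠ i, ∀ v : T.Vertex, {v.1} ∈ (T.B' j).faces → 0 ≤ lam j v)
    (hadj : ∀ j ≠ i, ∀ v w, T.graph.Adj v w → 0 ≤ lam j v * lam j w) :
    ∃ w, {w.1} ∈ (T.B' i).faces ∧ T.ReachableIn i {v | ∀ j ≠ i, lam j v = 0} w := by
  classical
  by_contra! hno
  set A := {v : T.Vertex | ∀ j ≠ i, lam j v = 0} with hA
  let cut (v : T.Vertex) : ℝ := if T.ReachableIn i A v then -1 else if v ∈ A then 1 else 0
  obtain ⟨v, hv⟩ := T.exists_vertex_labels_eq_zero (Function.update lam i cut)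
    (fun j v hvB => by
      rcases eq_or_ne j i with rfl | hj
      · rw [Function.update_self]
        by_cases hv : v ∈ A
        · have : T.ReachableIn j A v := ⟨v, hvB, .nil, by simpa using hv⟩
          simp [cut, this]
        · simp only [cut, hv, if_false]
          split_ifs <;> norm_num
      · rw [Function.update_of_ne hj]
        exact h0 j hj v hvB)
    (fun j v hvB => by
      rcases eq_or_ne j i with rfl | hj
      · rw [Function.update_self]
        simp only [cut, hno v hvB, if_false]
        split_ifs <;> norm_num
      · rw [Function.update_of_ne hj]
        exact h1 j hj v hvB)
    (fun j v w hvw => by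
      rcases eq_or_ne j i with rfl | hj
      · rw [Function.update_self]
        have hvw' := fun hv : T.ReachableIn j A v => hv.of_adj hvw
        have hwv' := fun hw : T.ReachableIn j A w => hw.of_adj hvw.symm
        simp only [cut]
        split_ifs <;> first | tauto | norm_num
      · rw [Function.update_of_ne hj]
        exact hadj j hj v w hvw)
  have hvA : v ∈ A := fun j hj => by simpa only [Function.update_of_ne hj] using hv j
  have := hv i
  simp only [Function.update_self, cut, hvA, if_true] at this
  split_ifs at this <;> norm_num at this

theorem exists_path_of_labels [Finite V] (T : DiscreteBox V n) (i : Fin n)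
    (lam : Fin n → T.Vertex → ℝ)
    (h0 : ∀ j ≠ i, ∀ v : T.Vertex, {v.1} ∈ (T.B j).faces → lam j v ≤ 0)
    (h1 : ∀ j ≠ i, ∀ v : T.Vertex, {v.1} ∈ (T.B' j).faces → 0 ≤ lam j v)
    (hadj : ∀ j ≠ i, ∀ v w, T.graph.Adj v w → 0 ≤ lam j v * lam j w) :
    ∃ v w : T.Vertex, {v.1} ∈ (T.B i).faces ∧ {w.1} ∈ (T.B' i).faces ∧
      ∃ γ : T.graph.Path v w, ∀ u ∈ γ.1.support, ∀ j ≠ i, lam j u = 0 := by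
  classical
  obtain ⟨w, hw, v, hv, p, hp⟩ := T.exists_reachableIn_of_labels i lam h0 h1 hadj
  exact ⟨v, w, hv, hw, p.toPath, fun u hu => hp u (p.support_toPath_subset_support hu)⟩

end DiscreteBox

/-! ### Packings of cubes -/

/-- Cubes indexed by the vertices of a discrete box, inside a geometric box, such that adjacent
cubes touch, the cubes of the boundary vertices touch the corresponding faces, and cubes of
positive side do not overlap. Unlike the cubes of a `CubeTiling`, they need not cover the box, and
a point-cube may lie inside another cube; this makes the notion stable under passing to a face. -/
structure CubePacking {V : Type*} {n : ℕ} (T : DiscreteBox V n) (h : Fin n → ℝ) where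
  corner : T.Vertex → Fin n → ℝ
  side : T.Vertex → ℝ≥0
  corner_nonneg : ∀ v j, 0 ≤ corner v j
  corner_add_le : ∀ v j, corner v j + side v ≤ h j
  separated : ∀ v w, v ≠ w → 0 < side v → 0 < side w →
    ∃ j, corner v j + side v ≤ corner w j ∨ corner w j + side w ≤ corner v j
  adj : ∀ v w, T.graph.Adj v w → ∀ j, corner v j ≤ corner w j + side w
  corner_eq : ∀ i (v : T.Vertex), {v.1} ∈ (T.B i).faces → corner v i = 0
  corner_add_eq : ∀ i (v : T.Vertex), {v.1} ∈ (T.B' i).faces → corner v i + side v = h i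

theorem interior_axisCube {n : ℕ} (a : Fin n → ℝ) (r : ℝ≥0) :
    interior (axisCube a r) = Set.univ.pi fun i => Set.Ioo (a i) (a i + r) := by
  rw [axisCube, ← Set.pi_univ_Icc, interior_pi_set Set.finite_univ]
  simp only [interior_Icc]

theorem volume_axisCube {n : ℕ} (a : Fin n → ℝ) (r : ℝ≥0) :
    MeasureTheory.volume (axisCube a r) = (r : ENNReal) ^ n := by
  simp [axisCube, Real.volume_Icc_pi]

namespace CubeTiling

variable {V : Type*} {n : ℕ} {T : DiscreteBox V n} {h : Fin n → ℝ}

theorem axisCube_subset (C : CubeTiling T h) (v : T.Vertex) :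
    axisCube (C.corner v) (C.side v) ⊆ Set.Icc 0 h :=
  C.cover ▸ Set.subset_iUnion (fun v => axisCube (C.corner v) (C.side v)) v

theorem corner_nonneg (C : CubeTiling T h) (v : T.Vertex) (j : Fin n) : 0 ≤ C.corner v j :=
  (C.axisCube_subset v (Set.left_mem_Icc.2 fun _ => le_add_of_nonneg_right (C.side v).2)).1 j

theorem corner_add_le (C : CubeTiling T h) (v : T.Vertex) (j : Fin n) :
    C.corner v j + C.side v ≤ h j :=
  (C.axisCube_subset v (Set.right_mem_Icc.2 fun _ => le_add_of_nonneg_right (C.side v).2)).2 j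

/-- The cubes of a tiling, as a packing. -/
def packing (C : CubeTiling T h) : CubePacking T h where
  corner := C.corner
  side := C.side
  corner_nonneg := C.corner_nonneg
  corner_add_le := C.corner_add_le
  separated v w hvw hv hw := by
    by_contra! hlt
    have overlap : ∀ j, (Set.Ioo (C.corner v j) (C.corner v j + C.side v) ∩
        Set.Ioo (C.corner w j) (C.corner w j + C.side w)).Nonempty := fun j => by
      rw [Set.Ioo_inter_Ioo, Set.nonempty_Ioo, max_lt_iff, lt_min_iff, lt_min_iff]
      exact ⟨⟨lt_add_of_pos_right _ hv, (hlt j).2⟩, (hlt j).1, lt_add_of_pos_right _ hw⟩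
    choose x hxv hxw using overlap
    have interior_v : x ∈ interior (axisCube (C.corner v) (C.side v)) := by
      rw [interior_axisCube]
      exact fun j _ => hxv j
    have interior_w : x ∈ interior (axisCube (C.corner w) (C.side w)) := by
      rw [interior_axisCube]
      exact fun j _ => hxw j
    exact (C.inter_subset v w hvw ⟨interior_subset interior_v, interior_subset interior_w⟩).1.2
      interior_v
  adj v w hvw j := by
    obtain ⟨x, hxv, hxw⟩ := C.adj v w hvw
    exact (hxv.1 j).trans (hxw.2 j)
  corner_eq i v hv := by
    obtain ⟨x, hx, hxi⟩ := C.meets i v hv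
    exact le_antisymm (hxi ▸ hx.1 i) (C.corner_nonneg v i)
  corner_add_eq i v hv := by
    obtain ⟨x, hx, hxi⟩ := C.meets' i v hv
    exact le_antisymm (C.corner_add_le v i) (hxi ▸ hx.2 i)

end CubeTiling

namespace CubePacking

variable {V : Type*}

/-- The packing of the renumbered discrete box by the cubes with permuted coordinates. -/
def permute {n : ℕ} {T : DiscreteBox V n} {h : Fin n → ℝ} (P : CubePacking T h)
    (σ : Equiv.Perm (Fin n)) : CubePacking (T.permute σ) (h ∘ σ) where
  corner v := P.corner v ∘ σ
  side := P.side
  corner_nonneg v j := P.corner_nonneg v (σ j)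
  corner_add_le v j := P.corner_add_le v (σ j)
  separated v w hvw hv hw := by
    obtain ⟨j, hj⟩ := P.separated v w hvw hv hw
    exact ⟨σ.symm j, by simpa using hj⟩
  adj v w hvw j := P.adj v w hvw (σ j)
  corner_eq i := P.corner_eq (σ i)
  corner_add_eq i := P.corner_add_eq (σ i)

section Projection

variable {n : ℕ} {T : DiscreteBox V (n + 1)} {h : Fin (n + 1) → ℝ}

/-- The projections along direction `i` of the cubes of the vertices of `T'`, a discrete box of one
dimension less inside `T`. They do not overlap if the cubes themselves all overlap in direction
`i`. -/
def project (P : CubePacking T h) (i : Fin (n + 1)) (T' : DiscreteBox V n)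
    (hK : T'.complex ≤ T.complex) (hB : ∀ j, T'.B j ≤ T.B (i.succAbove j))
    (hB' : ∀ j, T'.B' j ≤ T.B' (i.succAbove j))
    (overlap : ∀ v w : T'.Vertex, 0 < P.side ⟨v.1, hK v.2⟩ → 0 < P.side ⟨w.1, hK w.2⟩ →
      P.corner ⟨v.1, hK v.2⟩ i < P.corner ⟨w.1, hK w.2⟩ i + P.side ⟨w.1, hK w.2⟩) :
    CubePacking T' (i.removeNth h) where
  corner v := i.removeNth (P.corner ⟨v.1, hK v.2⟩)
  side v := P.side ⟨v.1, hK v.2⟩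
  corner_nonneg v j := P.corner_nonneg _ _
  corner_add_le v j := P.corner_add_le _ _
  separated v w hvw hv hw := by
    obtain ⟨j, hj⟩ := P.separated ⟨v.1, hK v.2⟩ ⟨w.1, hK w.2⟩
      (fun e => hvw (Subtype.ext (Subtype.mk.inj e))) hv hw
    rcases Fin.eq_self_or_eq_succAbove i j with rfl | ⟨j, rfl⟩
    · exact absurd hj (not_or_intro (overlap w v hw hv).not_ge (overlap v w hv hw).not_ge)
    · exact ⟨j, hj⟩
  adj v w hvw j := P.adj ⟨v.1, hK v.2⟩ ⟨w.1, hK w.2⟩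
    ⟨fun e => hvw.1 (Subtype.ext (Subtype.mk.inj e)),
      hvw.2.imp fun _ hs => ⟨hK hs.1, hs.2⟩⟩ _
  corner_eq j v hv := P.corner_eq _ _ (hB j hv)
  corner_add_eq j v hv := P.corner_add_eq _ _ (hB' j hv)

/-- The packing of the face `B i` by the faces of the cubes that stand on `{x i = 0}`. -/
def face (P : CubePacking T h) (i : Fin (n + 1)) : CubePacking (T.face i) (i.removeNth h) :=
  P.project i (T.face i) (T.B_le i) (fun _ => Set.inter_subset_right)
    (fun _ => Set.inter_subset_right) fun v w _ hw => by
      rw [P.corner_eq i ⟨v.1, _⟩ v.2, P.corner_eq i ⟨w.1, _⟩ w.2, zero_add]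
      exact hw

/-- The packing of the face `B' i` by the faces of the cubes that touch `{x i = h i}`. -/
def face' (P : CubePacking T h) (i : Fin (n + 1)) : CubePacking (T.face' i) (i.removeNth h) :=
  P.project i (T.face' i) (T.B'_le i) (fun _ => Set.inter_subset_right)
    (fun _ => Set.inter_subset_right) fun v w hv _ => by
      rw [P.corner_add_eq i ⟨w.1, _⟩ w.2, ← P.corner_add_eq i ⟨v.1, _⟩ v.2]
      exact lt_add_of_pos_right _ hv

/-- The projection of the cube of `v` along direction `i`. -/
def shadow (P : CubePacking T h) (i : Fin (n + 1)) (v : T.Vertex) : Set (Fin n → ℝ) :=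
  axisCube (i.removeNth (P.corner v)) (P.side v)

theorem measurableSet_shadow (P : CubePacking T h) (i : Fin (n + 1)) (v : T.Vertex) :
    MeasurableSet (P.shadow i v) :=
  measurableSet_Icc

theorem exists_path_of_line [Finite V] (P : CubePacking T h) (i : Fin (n + 1)) {y : Fin n → ℝ}
    (hy : y ∈ Set.Icc 0 (i.removeNth h)) :
    ∃ v w : T.Vertex, {v.1} ∈ (T.B i).faces ∧ {w.1} ∈ (T.B' i).faces ∧
      ∃ γ : T.graph.Path v w, ∀ u ∈ γ.1.support, y ∈ P.shadow i u := by
  let x : Fin (n + 1) → ℝ := i.insertNth (α := fun _ => ℝ) 0 y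
  have hx : ∀ j, x (i.succAbove j) = y j :=
    Fin.insertNth_apply_succAbove (α := fun _ => ℝ) i 0 y
  have hx_mem : ∀ j ≠ i, 0 ≤ x j ∧ x j ≤ h j := by
    intro j hj
    obtain ⟨j, rfl⟩ := Fin.exists_succAbove_eq hj
    rw [hx]
    exact ⟨hy.1 j, hy.2 j⟩
  let lam (j : Fin (n + 1)) (v : T.Vertex) : ℝ :=
    if x j < P.corner v j then 1 else if P.corner v j + P.side v < x j then -1 else 0
  have lam_eq_zero : ∀ j v, lam j v = 0 → P.corner v j ≤ x j ∧ x j ≤ P.corner v j + P.side v := by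
    intro j v hjv
    simp only [lam] at hjv
    split_ifs at hjv with h1 h2
    · norm_num at hjv
    · norm_num at hjv
    · exact ⟨not_lt.1 h1, not_lt.1 h2⟩
  obtain ⟨v, w, hv, hw, γ, hγ⟩ := T.exists_path_of_labels i lam
    (fun j hj v hv => by
      have := not_lt.2 (hx_mem j hj).1
      simp only [lam, P.corner_eq j v hv, this, if_false]
      split_ifs <;> norm_num)
    (fun j hj v hv => by
      have := not_lt.2 (hx_mem j hj).2
      simp only [lam, P.corner_add_eq j v hv, this, if_false]
      split_ifs <;> norm_num)
    (fun j _ v w hvw => by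
      have h1 := P.adj v w hvw j
      have h2 := P.adj w v hvw.symm j
      simp only [lam]
      split_ifs <;> first | (exfalso; linarith) | norm_num)
  refine ⟨v, w, hv, hw, γ, fun u hu => ⟨fun j => ?_, fun j => ?_⟩⟩
  · exact hx j ▸ (lam_eq_zero _ _ (hγ u hu _ (Fin.succAbove_ne i j))).1
  · exact hx j ▸ (lam_eq_zero _ _ (hγ u hu _ (Fin.succAbove_ne i j))).2

end Projection

end CubePacking

/-! ### Extremal length and extremal metrics -/

section PowerMeans

theorem young_defect_succ (k : ℕ) (x s : ℝ) :
    x ^ (k + 2) + (k + 1) * s ^ (k + 2) - (k + 1 + 1) * (x * s ^ (k + 1)) =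
      x * (x ^ (k + 1) + k * s ^ (k + 1) - (k + 1) * (x * s ^ k)) +
        (k + 1) * s ^ k * (x - s) ^ 2 := by
  ring

theorem succ_mul_mul_pow_le (k : ℕ) {x s : ℝ} (hx : 0 ≤ x) (hs : 0 ≤ s) :
    (k + 1) * (x * s ^ k) ≤ x ^ (k + 1) + k * s ^ (k + 1) := by
  induction k with
  | zero => simp
  | succ k ih =>
    push_cast
    rw [← sub_nonneg, young_defect_succ]
    exact add_nonneg (mul_nonneg hx (sub_nonneg.2 ih)) (by positivity)

theorem eq_of_succ_mul_mul_pow_eq {k : ℕ} (hk : k ≠ 0) {x s : ℝ} (hx : 0 ≤ x) (hs : 0 ≤ s)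
    (h : (k + 1) * (x * s ^ k) = x ^ (k + 1) + k * s ^ (k + 1)) : x = s := by
  obtain ⟨k, rfl⟩ := Nat.exists_eq_add_one_of_ne_zero hk
  rcases hs.eq_or_lt with rfl | hs
  · simpa using h.symm
  · push_cast at h
    rw [eq_comm, ← sub_eq_zero, young_defect_succ, add_eq_zero_iff_of_nonneg
      (mul_nonneg hx (sub_nonneg.2 (succ_mul_mul_pow_le k hx hs.le))) (by positivity)] at h
    have : (k + 1) * s ^ k ≠ 0 := by positivity
    simpa [this, sub_eq_zero] using h.2

variable {ι : Type*} [Fintype ι] {k : ℕ} {x y : ι → ℝ} {A B : ℝ}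

theorem succ_mul_sum_mul_pow_scaled (k : ℕ) (x y : ι → ℝ) (A B : ℝ) :
    ∑ i, (k + 1) * (B * x i * (A * y i) ^ k) = (k + 1) * (B * A ^ k) * ∑ i, x i * y i ^ k := by
  rw [Finset.mul_sum]
  exact Finset.sum_congr rfl fun i _ => by ring

theorem sum_pow_scaled (hx : ∑ i, x i ^ (k + 1) = A ^ (k + 1))
    (hy : ∑ i, y i ^ (k + 1) = B ^ (k + 1)) :
    ∑ i, ((B * x i) ^ (k + 1) + k * (A * y i) ^ (k + 1)) =
      (k + 1) * (B * A ^ k) * (A * B ^ k) := by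
  simp only [mul_pow, Finset.sum_add_distrib, ← Finset.mul_sum, hx, hy]
  ring

/- Applying Young's inequality to `B * x i` and `A * y i` puts both families on the same scale. -/
theorem sum_mul_pow_le (hx0 : ∀ i, 0 ≤ x i) (hy0 : ∀ i, 0 ≤ y i) (hA : 0 < A) (hB : 0 < B)
    (hx : ∑ i, x i ^ (k + 1) = A ^ (k + 1)) (hy : ∑ i, y i ^ (k + 1) = B ^ (k + 1)) :
    ∑ i, x i * y i ^ k ≤ A * B ^ k := by
  refine le_of_mul_le_mul_left ?_ (by positivity : 0 < (k + 1) * (B * A ^ k))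
  rw [← succ_mul_sum_mul_pow_scaled, ← sum_pow_scaled hx hy]
  exact Finset.sum_le_sum fun i _ =>
    succ_mul_mul_pow_le k (mul_nonneg hB.le (hx0 i)) (mul_nonneg hA.le (hy0 i))

theorem mul_eq_mul_of_sum_mul_pow_eq (hk : k ≠ 0) (hx0 : ∀ i, 0 ≤ x i) (hy0 : ∀ i, 0 ≤ y i)
    (hA : 0 ≤ A) (hB : 0 ≤ B)
    (hx : ∑ i, x i ^ (k + 1) = A ^ (k + 1)) (hy : ∑ i, y i ^ (k + 1) = B ^ (k + 1))
    (h : ∑ i, x i * y i ^ k = A * B ^ k) (i : ι) : B * x i = A * y i := by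
  have hBx := fun i => mul_nonneg hB (hx0 i)
  have hAy := fun i => mul_nonneg hA (hy0 i)
  have sums_eq := (succ_mul_sum_mul_pow_scaled k x y A B).trans
    ((congrArg _ h).trans (sum_pow_scaled hx hy).symm)
  exact eq_of_succ_mul_mul_pow_eq hk (hBx i) (hAy i) <|
    (Finset.sum_eq_sum_iff_of_le fun i _ => succ_mul_mul_pow_le k (hBx i) (hAy i)).1 sums_eq i
      (Finset.mem_univ i)

end PowerMeans

namespace DiscreteBox

variable {V : Type*} {n : ℕ} [NeZero n]

theorem length_le_sum_map_support (T : DiscreteBox V n) (m : T.Vertex → ℝ≥0) {v w : T.Vertex}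
    (hv : {v.1} ∈ (T.B 0).faces) (hw : {w.1} ∈ (T.B' 0).faces) (γ : T.graph.Path v w) :
    T.length m ≤ (γ.1.support.map fun u => (m u : ℝ)).sum := by
  refine csInf_le ⟨0, ?_⟩ ⟨v, w, hv, hw, γ, rfl⟩
  rintro _ ⟨_, _, _, _, γ, rfl⟩
  refine List.sum_nonneg fun x hx => ?_
  obtain ⟨u, _, rfl⟩ := List.mem_map.1 hx
  exact (m u).2

theorem length_le_sum_indicator [Finite V] (T : DiscreteBox V n) (m : T.Vertex → ℝ≥0)
    {v w : T.Vertex} (hv : {v.1} ∈ (T.B 0).faces) (hw : {w.1} ∈ (T.B' 0).faces)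
    (γ : T.graph.Path v w) {A : Set T.Vertex} (hγ : ∀ u ∈ γ.1.support, u ∈ A) :
    T.length m ≤ ∑ u, ((A.indicator m u : ℝ≥0) : ℝ) := by
  classical
  calc T.length m ≤ (γ.1.support.map fun u => (m u : ℝ)).sum :=
        T.length_le_sum_map_support m hv hw γ
    _ = ∑ u ∈ γ.1.support.toFinset, (m u : ℝ) := (List.sum_toFinset _ γ.2.support_nodup).symm
    _ = ∑ u ∈ γ.1.support.toFinset, ((A.indicator m u : ℝ≥0) : ℝ) :=
        Finset.sum_congr rfl fun u hu => by
          rw [Set.indicator_of_mem (hγ u (List.mem_toFinset.1 hu))]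
    _ ≤ ∑ u, ((A.indicator m u : ℝ≥0) : ℝ) :=
        Finset.sum_le_univ_sum_of_nonneg fun u => (A.indicator m u).2

theorem pathLengths_nonempty [Finite V] (T : DiscreteBox V n) (m : T.Vertex → ℝ≥0) :
    (T.pathLengths m).Nonempty := by
  obtain ⟨v, w, hv, hw, γ, -⟩ := T.exists_path_of_labels 0 0 (by simp) (by simp) (by simp)
  exact ⟨_, v, w, hv, hw, γ, rfl⟩

theorem sum_pow_eq_volume_pow [Finite V] (T : DiscreteBox V n) (m : T.Vertex → ℝ≥0) :
    ∑ v, (m v : ℝ) ^ n = T.volume m ^ n := by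
  rw [volume, one_div]
  exact (Real.rpow_inv_natCast_pow
    (Finset.sum_nonneg fun v _ => pow_nonneg (m v).2 n) (NeZero.ne n)).symm

end DiscreteBox

namespace CubePacking

variable {V : Type*}

theorem le_sum_side_of_walk {n : ℕ} {T : DiscreteBox V n} {h : Fin n → ℝ} (P : CubePacking T h)
    (j : Fin n) {v w : T.Vertex} (p : T.graph.Walk v w) :
    P.corner w j + P.side w ≤ P.corner v j + (p.support.map fun u => (P.side u : ℝ)).sum := by
  induction p with
  | nil => simp
  | cons hvu p ih =>
    rw [SimpleGraph.Walk.support_cons, List.map_cons, List.sum_cons, ← add_assoc]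
    exact ih.trans (add_le_add_left (P.adj _ _ hvu.symm j) _)

theorem le_length_side [Finite V] {n : ℕ} [NeZero n] {T : DiscreteBox V n} {h : Fin n → ℝ}
    (P : CubePacking T h) : h 0 ≤ T.length P.side := by
  refine le_csInf (T.pathLengths_nonempty P.side) ?_
  rintro _ ⟨v, w, hv, hw, γ, rfl⟩
  simpa only [P.corner_add_eq 0 w hw, P.corner_eq 0 v hv, zero_add] using
    P.le_sum_side_of_walk 0 γ.1

theorem sum_side_pow_le [Finite V] {n : ℕ} [NeZero n] {T : DiscreteBox V n} {h : Fin n → ℝ}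
    (P : CubePacking T h) (h0 : ∀ i, 0 ≤ h i) : ∑ v, (P.side v : ℝ) ^ n ≤ ∏ i, h i := by
  let openCube (v : T.Vertex) : Set (Fin n → ℝ) :=
    Set.univ.pi fun j => Set.Ioo (P.corner v j) (P.corner v j + P.side v)
  have side_pos : ∀ {v x}, x ∈ openCube v → 0 < P.side v := fun {v x} hx =>
    NNReal.coe_pos.1 (lt_add_iff_pos_right _ |>.1 ((hx 0 trivial).1.trans (hx 0 trivial).2))
  have disjoint : Pairwise (Function.onFun Disjoint openCube) := by
    refine fun v w hvw => Set.disjoint_left.2 fun x hv hw => ?_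
    obtain ⟨j, hj | hj⟩ := P.separated v w hvw (side_pos hv) (side_pos hw)
    · exact ((hv j trivial).2.trans_le hj).not_gt (hw j trivial).1
    · exact ((hw j trivial).2.trans_le hj).not_gt (hv j trivial).1
  have volume_openCube : ∀ v, MeasureTheory.volume (openCube v) = ENNReal.ofReal (P.side v ^ n) :=
    fun v => by simp [openCube, Real.volume_pi_Ioo]
  have union_subset : ⋃ v, openCube v ⊆ Set.Icc 0 h := Set.iUnion_subset fun v x hx =>
    ⟨fun j => (P.corner_nonneg v j).trans (hx j trivial).1.le,
      fun j => (hx j trivial).2.le.trans (P.corner_add_le v j)⟩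
  have := MeasureTheory.measure_mono (μ := MeasureTheory.volume) union_subset
  rw [MeasureTheory.measure_iUnion disjoint fun v =>
      MeasurableSet.univ_pi fun _ => measurableSet_Ioo, tsum_fintype] at this
  simp only [volume_openCube, Real.volume_Icc_pi, Pi.zero_apply, sub_zero] at this
  rwa [← ENNReal.ofReal_sum_of_nonneg fun v _ => by positivity,
    ← ENNReal.ofReal_prod_of_nonneg fun i _ => h0 i,
    ENNReal.ofReal_le_ofReal_iff (Finset.prod_nonneg fun i _ => h0 i)] at this

section ExtremalLength

variable [Finite V] {k : ℕ} {T : DiscreteBox V (k + 1)} {h : Fin (k + 1) → ℝ}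

theorem lintegral_sum_indicator_shadow (P : CubePacking T h) (i : Fin (k + 1))
    (m : T.Vertex → ℝ≥0) :
    ∫⁻ y, ∑ v, (P.shadow i v).indicator (fun _ => (m v : ENNReal)) y =
      ENNReal.ofReal (∑ v, (m v : ℝ) * P.side v ^ k) := by
  rw [MeasureTheory.lintegral_finsetSum _ fun v _ =>
      measurable_const.indicator (P.measurableSet_shadow i v),
    ENNReal.ofReal_sum_of_nonneg fun v _ => by positivity]
  refine Finset.sum_congr rfl fun v _ => ?_
  rw [MeasureTheory.lintegral_indicator_const (P.measurableSet_shadow i v), shadow,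
    volume_axisCube, ENNReal.ofReal_mul (by positivity), ENNReal.ofReal_pow (by positivity)]
  simp

/- Integrate the inequality `length m ≤ ∑ {m v | the line over y meets the cube of v}` over `y`. -/
theorem length_mul_prod_le (P : CubePacking T h) (h0 : ∀ i, 0 ≤ h i) (m : T.Vertex → ℝ≥0) :
    T.length m * ∏ i : Fin k, h i.succ ≤ ∑ v, (m v : ℝ) * P.side v ^ k := by
  have line_bound : ∀ y ∈ Set.Icc 0 ((0 : Fin (k + 1)).removeNth h),
      ENNReal.ofReal (T.length m) ≤ ∑ v, (P.shadow 0 v).indicator (fun _ => (m v : ENNReal)) y := by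
    intro y hy
    obtain ⟨v, w, hv, hw, γ, hγ⟩ := P.exists_path_of_line 0 hy
    have := T.length_le_sum_indicator m hv hw γ (A := {u | y ∈ P.shadow 0 u}) hγ
    rw [← NNReal.coe_sum, ← ENNReal.ofReal_le_coe, ENNReal.ofNNReal_finsetSum] at this
    refine this.trans_eq (Finset.sum_congr rfl fun u _ => ?_)
    by_cases hu : y ∈ P.shadow 0 u <;> simp [hu]
  rw [← ENNReal.ofReal_le_ofReal_iff (by positivity)]
  calc ENNReal.ofReal (T.length m * ∏ i : Fin k, h i.succ)
      = ∫⁻ _ in Set.Icc 0 ((0 : Fin (k + 1)).removeNth h), ENNReal.ofReal (T.length m) := by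
        rw [MeasureTheory.setLIntegral_const, Real.volume_Icc_pi,
          ENNReal.ofReal_mul' (Finset.prod_nonneg fun i _ => h0 i.succ),
          ENNReal.ofReal_prod_of_nonneg fun i _ => h0 i.succ]
        simp [Fin.removeNth]
    _ ≤ ∫⁻ y in Set.Icc 0 ((0 : Fin (k + 1)).removeNth h),
          ∑ v, (P.shadow 0 v).indicator (fun _ => (m v : ENNReal)) y :=
        MeasureTheory.setLIntegral_mono' measurableSet_Icc line_bound
    _ ≤ ∫⁻ y, ∑ v, (P.shadow 0 v).indicator (fun _ => (m v : ENNReal)) y :=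
        MeasureTheory.setLIntegral_le_lintegral _ _
    _ = ENNReal.ofReal (∑ v, (m v : ℝ) * P.side v ^ k) := P.lintegral_sum_indicator_shadow 0 m

theorem length_side_and_sum_side_pow (P : CubePacking T h) (hpos : ∀ i, 0 < h i) :
    T.length P.side = h 0 ∧ ∑ v, (P.side v : ℝ) ^ (k + 1) = ∏ i, h i := by
  have length_mul_prod := P.length_mul_prod_le (fun i => (hpos i).le) P.side
  simp only [← pow_succ'] at length_mul_prod
  have sum_le := P.sum_side_pow_le fun i => (hpos i).le
  have le_length := P.le_length_side
  have prod_pos : 0 < ∏ i : Fin k, h i.succ := Finset.prod_pos fun i _ => hpos i.succ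
  have le_sum := (mul_le_mul_of_nonneg_right le_length prod_pos.le).trans length_mul_prod
  rw [Fin.prod_univ_succ] at sum_le ⊢
  exact ⟨le_antisymm (le_of_mul_le_mul_right (length_mul_prod.trans sum_le) prod_pos) le_length,
    le_antisymm sum_le le_sum⟩

theorem length_side (P : CubePacking T h) (hpos : ∀ i, 0 < h i) : T.length P.side = h 0 :=
  (P.length_side_and_sum_side_pow hpos).1

theorem sum_side_pow (P : CubePacking T h) (hpos : ∀ i, 0 < h i) :
    ∑ v, (P.side v : ℝ) ^ (k + 1) = ∏ i, h i :=
  (P.length_side_and_sum_side_pow hpos).2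

theorem volume_side (P : CubePacking T h) (hpos : ∀ i, 0 < h i) :
    T.volume P.side = (∏ i, h i) ^ ((1 : ℝ) / (k + 1 : ℕ)) := by
  rw [DiscreteBox.volume, P.sum_side_pow hpos]

theorem volume_side_pos (P : CubePacking T h) (hpos : ∀ i, 0 < h i) : 0 < T.volume P.side := by
  rw [P.volume_side hpos]
  exact Real.rpow_pos_of_pos (Finset.prod_pos fun i _ => hpos i) _

theorem volume_side_pow (P : CubePacking T h) (hpos : ∀ i, 0 < h i) :
    T.volume P.side ^ (k + 1) = h 0 * ∏ i : Fin k, h i.succ := by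
  rw [← T.sum_pow_eq_volume_pow, P.sum_side_pow hpos, Fin.prod_univ_succ]

theorem normalizedLength_mul_le (P : CubePacking T h) (h0 : ∀ i, 0 ≤ h i)
    {m : T.Vertex → ℝ≥0} (hm : 0 < T.volume m) :
    T.normalizedLength m * (T.volume m * ∏ i : Fin k, h i.succ) ≤
      ∑ v, (m v : ℝ) * P.side v ^ k := by
  rw [DiscreteBox.normalizedLength, ← mul_assoc, div_mul_cancel₀ _ hm.ne']
  exact P.length_mul_prod_le h0 m

theorem normalizedLength_side_mul (P : CubePacking T h) (hpos : ∀ i, 0 < h i) (A : ℝ) :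
    T.normalizedLength P.side * (A * ∏ i : Fin k, h i.succ) = A * T.volume P.side ^ k := by
  have := (P.volume_side_pos hpos).ne'
  rw [DiscreteBox.normalizedLength, P.length_side hpos]
  field_simp
  linear_combination -A * P.volume_side_pow hpos

theorem normalizedLength_le (P : CubePacking T h) (hpos : ∀ i, 0 < h i)
    {m : T.Vertex → ℝ≥0} (hm : 0 < T.volume m) :
    T.normalizedLength m ≤ T.normalizedLength P.side := by
  have prod_pos : 0 < ∏ i : Fin k, h i.succ := Finset.prod_pos fun i _ => hpos i.succ
  refine le_of_mul_le_mul_right ?_ (mul_pos hm prod_pos)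
  rw [P.normalizedLength_side_mul hpos]
  exact (P.normalizedLength_mul_le (fun i => (hpos i).le) hm).trans <|
    sum_mul_pow_le (fun v => (m v).2) (fun v => (P.side v).2) hm (P.volume_side_pos hpos)
      (T.sum_pow_eq_volume_pow m) (T.sum_pow_eq_volume_pow P.side)

theorem isExtremal_side (P : CubePacking T h) (hpos : ∀ i, 0 < h i) : T.IsExtremal P.side :=
  ⟨P.volume_side_pos hpos, Eq.symm <| IsGreatest.csSup_eq
    ⟨Set.mem_image_of_mem _ (P.volume_side_pos hpos),
      Set.forall_mem_image.2 fun _ hm => P.normalizedLength_le hpos hm⟩⟩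

theorem EL_eq (P : CubePacking T h) (hpos : ∀ i, 0 < h i) :
    T.EL = h 0 / (∏ i, h i) ^ ((1 : ℝ) / (k + 1 : ℕ)) := by
  rw [← (P.isExtremal_side hpos).2, DiscreteBox.normalizedLength, P.length_side hpos,
    P.volume_side hpos]

theorem volume_side_mul_eq_of_isExtremal (P : CubePacking T h) (hpos : ∀ i, 0 < h i)
    (hk : k ≠ 0) {m : T.Vertex → ℝ≥0} (hm : T.IsExtremal m) (v : T.Vertex) :
    T.volume P.side * m v = T.volume m * P.side v := by
  have volume_pos := P.volume_side_pos hpos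
  have holder_eq : ∑ v, (m v : ℝ) * P.side v ^ k = T.volume m * T.volume P.side ^ k := by
    refine le_antisymm (sum_mul_pow_le (fun v => (m v).2) (fun v => (P.side v).2) hm.1 volume_pos
      (T.sum_pow_eq_volume_pow m) (T.sum_pow_eq_volume_pow P.side)) ?_
    rw [← P.normalizedLength_side_mul hpos, (P.isExtremal_side hpos).2, ← hm.2]
    exact P.normalizedLength_mul_le (fun i => (hpos i).le) hm.1
  exact mul_eq_mul_of_sum_mul_pow_eq hk (fun v => (m v).2) (fun v => (P.side v).2) hm.1.le
    volume_pos.le (T.sum_pow_eq_volume_pow m) (T.sum_pow_eq_volume_pow P.side) holder_eq v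

theorem eq_of_side_eq_of_isExtremal (P : CubePacking T h) (hpos : ∀ i, 0 < h i)
    (hk : k ≠ 0) {m : T.Vertex → ℝ≥0} (hm : T.IsExtremal m) {v w : T.Vertex}
    (hvw : P.side v = P.side w) : m v = m w :=
  NNReal.coe_injective <| mul_left_cancel₀ (P.volume_side_pos hpos).ne' <| by
    rw [P.volume_side_mul_eq_of_isExtremal hpos hk hm, hvw,
      P.volume_side_mul_eq_of_isExtremal hpos hk hm]

theorem pos_of_side_pos_of_isExtremal (P : CubePacking T h) (hpos : ∀ i, 0 < h i)
    (hk : k ≠ 0) {m : T.Vertex → ℝ≥0} (hm : T.IsExtremal m) {v : T.Vertex}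
    (hv : 0 < P.side v) : 0 < m v :=
  NNReal.coe_pos.1 <| pos_of_mul_pos_right
    (P.volume_side_mul_eq_of_isExtremal hpos hk hm v ▸ mul_pos hm.1 hv)
    (P.volume_side_pos hpos).le

theorem EL_permute (P : CubePacking T h) (hpos : ∀ i, 0 < h i) (σ : Equiv.Perm (Fin (k + 1))) :
    (T.permute σ).EL = h (σ 0) / (∏ i, h i) ^ ((1 : ℝ) / (k + 1 : ℕ)) := by
  rw [(P.permute σ).EL_eq fun i => hpos (σ i), ← Equiv.prod_comp σ h]
  rfl

theorem prod_EL_permute (P : CubePacking T h) (hpos : ∀ i, 0 < h i)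
    (σ : Fin (k + 1) → Equiv.Perm (Fin (k + 1))) (hσ : ∀ i, σ i 0 = i) :
    ∏ i, (T.permute (σ i)).EL = 1 := by
  have prod_pos : 0 < ∏ i, h i := Finset.prod_pos fun i _ => hpos i
  simp only [P.EL_permute hpos, hσ, Finset.prod_div_distrib, Finset.prod_const, Finset.card_univ,
    Fintype.card_fin, one_div, Real.rpow_inv_natCast_pow prod_pos.le k.succ_ne_zero,
    div_self prod_pos.ne']

end ExtremalLength

theorem EL_permute_face_eq [Finite V] {k : ℕ} {T : DiscreteBox V (k + 2)} {h : Fin (k + 2) → ℝ}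
    (P : CubePacking T h) (hpos : ∀ i, 0 < h i) (i : Fin (k + 2))
    (τ : Equiv.Perm (Fin (k + 1))) :
    ((T.face i).permute τ).EL = ((T.face' i).permute τ).EL :=
  ((P.face i).EL_permute (fun _ => hpos _) τ).trans
    ((P.face' i).EL_permute (fun _ => hpos _) τ).symm

end CubePacking

/-! ### Tilings by cubes of distinct sizes -/

/-- A one-sided germ at a point of the line: `(x, false)` stands for the points immediately to the
left of `x` and `(x, true)` for those immediately to its right. Cubes which tile a box may share
boundary points, but they share no germs. -/
abbrev Germ : Type := ℝ ×ₗ Bool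

/-- The germ of the points immediately to the left of `x`. -/
def leftGerm (x : ℝ) : Germ := toLex (x, false)

/-- The germ of the points immediately to the right of `x`. -/
def rightGerm (x : ℝ) : Germ := toLex (x, true)

/-- The germs of the points of the interval `[a, b]`. -/
def germInterval (a b : ℝ) : Set Germ := Set.Icc (rightGerm a) (leftGerm b)

/-- The tuples of germs of the points of the box with opposite corners `p` and `q`. -/
def germBox {ι : Type*} (p q : ι → ℝ) : Set (ι → Germ) :=
  Set.univ.pi fun j => germInterval (p j) (q j)

section Germ

variable {x y a b c d s : ℝ}

theorem rightGerm_le_leftGerm : rightGerm x ≤ leftGerm y ↔ x < y :=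
  Prod.Lex.toLex_le_toLex.trans (by simp)

theorem rightGerm_le_rightGerm : rightGerm x ≤ rightGerm y ↔ x ≤ y :=
  Prod.Lex.toLex_le_toLex.trans (by simp [le_iff_lt_or_eq])

theorem leftGerm_le_leftGerm : leftGerm x ≤ leftGerm y ↔ x ≤ y :=
  Prod.Lex.toLex_le_toLex.trans (by simp [le_iff_lt_or_eq])

theorem rightGerm_mem_germInterval : rightGerm x ∈ germInterval a b ↔ a ≤ x ∧ x < b :=
  and_congr rightGerm_le_rightGerm rightGerm_le_leftGerm

theorem leftGerm_mem_germInterval : leftGerm x ∈ germInterval a b ↔ a < x ∧ x ≤ b :=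
  and_congr rightGerm_le_leftGerm leftGerm_le_leftGerm

theorem lt_of_mem_germInterval {g : Germ} (h : g ∈ germInterval a b) (h' : g ∈ germInterval c d) :
    a < d :=
  rightGerm_le_leftGerm.1 (h.1.trans h'.2)

theorem germInterval_subset_germInterval (h : a < b) :
    germInterval a b ⊆ germInterval c d ↔ c ≤ a ∧ b ≤ d := by
  rw [germInterval, germInterval, Set.Icc_subset_Icc_iff (rightGerm_le_leftGerm.2 h),
    rightGerm_le_rightGerm, leftGerm_le_leftGerm]

theorem exists_mem_germInterval_notMem (hs : 0 < s) (h : c < s) (a b : ℝ) :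
    ∃ g ∈ germInterval a (a + s), g ∉ germInterval b (b + c) := by
  refine Set.not_subset.1 fun hsub => ?_
  have := (germInterval_subset_germInterval (lt_add_of_pos_right a hs)).1 hsub
  linarith

theorem germInterval_subset_of_inter_subset {p q : ℝ} (hpa : p < a) (hab : a < b) (hbq : b < q)
    (hne : (germInterval c d ∩ germInterval a b).Nonempty)
    (hsub : germInterval c d ∩ germInterval p q ⊆ germInterval a b) :
    germInterval c d ⊆ germInterval a b := by
  obtain ⟨g, hgcd, hgab⟩ := hne
  have hcd := lt_of_mem_germInterval hgcd hgcd
  have hcb := lt_of_mem_germInterval hgcd hgab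
  have had := lt_of_mem_germInterval hgab hgcd
  rw [germInterval_subset_germInterval hcd]
  constructor <;> by_contra! hlt
  · have := hsub ⟨leftGerm_mem_germInterval.2 ⟨hlt, had.le⟩,
      leftGerm_mem_germInterval.2 ⟨hpa, (hab.trans hbq).le⟩⟩
    exact (leftGerm_mem_germInterval.1 this).1.false
  · have := hsub ⟨rightGerm_mem_germInterval.2 ⟨hcb.le, hlt⟩,
      rightGerm_mem_germInterval.2 ⟨(hpa.trans hab).le, hbq⟩⟩
    exact (rightGerm_mem_germInterval.1 this).2.false

theorem update_mem_germBox {ι : Type*} [DecidableEq ι] {p q : ι → ℝ} {γ : ι → Germ}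
    (hγ : γ ∈ germBox p q) {j : ι} {g : Germ} (hg : g ∈ germInterval (p j) (q j)) :
    Function.update γ j g ∈ germBox p q :=
  (Set.update_mem_pi_iff_of_mem hγ).2 fun _ => hg

theorem mem_of_update_mem_germBox {ι : Type*} [DecidableEq ι] {p q : ι → ℝ} {γ : ι → Germ}
    {j : ι} {g : Germ} (h : Function.update γ j g ∈ germBox p q)
    (hj : γ j ∈ germInterval (p j) (q j)) : γ ∈ germBox p q := by
  simpa using update_mem_germBox h hj

theorem germBox_mono {ι : Type*} {p q p' q' : ι → ℝ} (hp : ∀ j, p' j ≤ p j)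
    (hq : ∀ j, q j ≤ q' j) : germBox p q ⊆ germBox p' q' :=
  Set.pi_mono fun j _ => Set.Icc_subset_Icc (rightGerm_le_rightGerm.2 (hp j))
    (leftGerm_le_leftGerm.2 (hq j))

theorem cons_mem_germBox {n : ℕ} {p q : Fin (n + 1) → ℝ} {g : Germ} {γ : Fin n → Germ} :
    (Fin.cons g γ : Fin (n + 1) → Germ) ∈ germBox p q ↔
      g ∈ germInterval (p 0) (q 0) ∧ γ ∈ germBox (Fin.tail p) (Fin.tail q) := by
  simp [germBox, Set.mem_pi, Fin.forall_fin_succ, Fin.tail]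

end Germ

/-- A tiling of the box with opposite corners `p` and `q` by the cubes with lowest corners `a w`
and positive sides `s w`: each germ of the box belongs to exactly one cube. -/
structure IsCubing {ι K : Type*} (p q : ι → ℝ) (a : K → ι → ℝ) (s : K → ℝ) : Prop where
  side_pos : ∀ w, 0 < s w
  le_corner : ∀ w j, p j ≤ a w j
  corner_add_le : ∀ w j, a w j + s w ≤ q j
  existsUnique : ∀ γ ∈ germBox p q, ∃! w, γ ∈ germBox (a w) fun j => a w j + s w

namespace IsCubing

section Smallest

variable {ι K : Type*} {p q : ι → ℝ} {a : K → ι → ℝ} {s : K → ℝ}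

theorem mem_of_mem (H : IsCubing p q a s) {w : K} {γ : ι → Germ}
    (hγ : γ ∈ germBox (a w) fun j => a w j + s w) : γ ∈ germBox p q :=
  germBox_mono (H.le_corner w) (H.corner_add_le w) hγ

theorem eq_of_mem (H : IsCubing p q a s) {w w' : K} {γ : ι → Germ}
    (hw : γ ∈ germBox (a w) fun j => a w j + s w)
    (hw' : γ ∈ germBox (a w') fun j => a w' j + s w') : w = w' :=
  (H.existsUnique γ (H.mem_of_mem hw)).unique hw hw'

theorem rightGerm_mem (H : IsCubing p q a s) (w : K) :
    (fun j => rightGerm (a w j)) ∈ germBox (a w) fun j => a w j + s w :=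
  fun _ _ => rightGerm_mem_germInterval.2 ⟨le_rfl, lt_add_of_pos_right _ (H.side_pos w)⟩

theorem nonempty (H : IsCubing p q a s) (hpq : ∀ j, p j < q j) : Nonempty K :=
  ⟨(H.existsUnique (fun j => rightGerm (p j))
    fun j _ => rightGerm_mem_germInterval.2 ⟨le_rfl, hpq j⟩).choose⟩

/- Some cube contains the germs `far` and `g`, hence it also contains the germ `near` of `c`. -/
theorem exists_mem_near_notMem_far (H : IsCubing p q a s) [Nontrivial ι] {c : K}
    (hc : ∀ w ≠ c, s c < s w) (j : ι) {near far : Germ}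
    (near_mem : near ∈ germInterval (a c j) (a c j + s c))
    (far_mem : far ∈ germInterval (p j) (q j))
    (far_notMem : far ∉ germInterval (a c j) (a c j + s c)) :
    ∃ w ≠ c, near ∈ germInterval (a w j) (a w j + s w) ∧
      far ∉ germInterval (a w j) (a w j + s w) := by
  classical
  by_contra! hfar
  obtain ⟨k, hk⟩ := exists_ne j
  let γ : ι → Germ := Function.update (fun i => rightGerm (a c i)) j near
  have hγ : γ ∈ germBox (a c) fun i => a c i + s c :=
    update_mem_germBox (H.rightGerm_mem c) near_mem
  have hγj : γ j = near := Function.update_self ..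
  obtain ⟨w, hw, -⟩ := H.existsUnique _ (update_mem_germBox (H.mem_of_mem hγ) far_mem)
  have hw_far : far ∈ germInterval (a w j) (a w j + s w) := by simpa using hw j trivial
  have hwc : w ≠ c := by
    rintro rfl
    exact far_notMem hw_far
  obtain ⟨g, hgw, hgc⟩ := exists_mem_germInterval_notMem (H.side_pos w) (hc w hwc) (a w k) (a c k)
  have hg : g ∈ germInterval (p k) (q k) := by
    simpa using H.mem_of_mem (update_mem_germBox hw hgw) k trivial
  obtain ⟨w', hw', -⟩ := H.existsUnique _ (update_mem_germBox (H.mem_of_mem hγ) hg)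
  have hwc' : w' ≠ c := by
    rintro rfl
    exact hgc (by simpa using hw' k trivial)
  have hw'_near : near ∈ germInterval (a w' j) (a w' j + s w') := by
    simpa [hk.symm, hγj] using hw' j trivial
  have hw'_far := update_mem_germBox hw' (hfar w' hwc' hw'_near)
  have hw_g := update_mem_germBox hw hgw
  rw [Function.update_comm hk.symm] at hw_g
  obtain rfl : w = w' := H.eq_of_mem hw_g hw'_far
  exact hwc (H.eq_of_mem (mem_of_update_mem_germBox hw (hγj ▸ hw'_near)) hγ)

theorem lt_corner_of_smallest (H : IsCubing p q a s) [Nontrivial ι] {c : K}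
    (hc : ∀ w ≠ c, s c < s w) (hlt : ∀ j, s c < q j - p j) (j : ι) : p j < a c j := by
  by_contra! hle
  have corner_eq : a c j = p j := le_antisymm hle (H.le_corner c j)
  have side_pos := H.side_pos c
  have := hlt j
  obtain ⟨w, hwc, hnear, hfar⟩ := H.exists_mem_near_notMem_far hc j
    (near := rightGerm (p j)) (far := rightGerm (p j + s c))
    (rightGerm_mem_germInterval.2 ⟨corner_eq.le, by linarith⟩)
    (rightGerm_mem_germInterval.2 ⟨by linarith, by linarith⟩)
    (fun h => by linarith [(rightGerm_mem_germInterval.1 h).2])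
  have corner_le := (rightGerm_mem_germInterval.1 hnear).1
  exact hfar (rightGerm_mem_germInterval.2
    ⟨by linarith, by linarith [H.le_corner w j, hc w hwc]⟩)

theorem corner_add_lt_of_smallest (H : IsCubing p q a s) [Nontrivial ι] {c : K}
    (hc : ∀ w ≠ c, s c < s w) (hlt : ∀ j, s c < q j - p j) (j : ι) : a c j + s c < q j := by
  by_contra! hle
  have corner_eq : a c j + s c = q j := le_antisymm (H.corner_add_le c j) hle
  have side_pos := H.side_pos c
  have := hlt j
  obtain ⟨w, hwc, hnear, hfar⟩ := H.exists_mem_near_notMem_far hc j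
    (near := leftGerm (q j)) (far := leftGerm (q j - s c))
    (leftGerm_mem_germInterval.2 ⟨by linarith, corner_eq.ge⟩)
    (leftGerm_mem_germInterval.2 ⟨by linarith, by linarith⟩)
    (fun h => by linarith [(leftGerm_mem_germInterval.1 h).1])
  have le_corner_add := (leftGerm_mem_germInterval.1 hnear).2
  exact hfar (leftGerm_mem_germInterval.2
    ⟨by linarith [H.corner_add_le w j, hc w hwc], by linarith⟩)

end Smallest

end IsCubing

section Valley

variable {d : ℕ} {K : Type*}

/-- The cube `w` stands at height `t` (in direction `0`) inside the floor with opposite corners `l`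
and `u`, and is narrower than the floor. -/
def StandsOn (a : K → Fin (d + 1) → ℝ) (s : K → ℝ) (t : ℝ) (l u : Fin d → ℝ) (w : K) : Prop :=
  a w 0 = t ∧ ∀ j, l j ≤ a w j.succ ∧ a w j.succ + s w ≤ u j ∧ s w < u j - l j

/-- The floor with opposite corners `l` and `u` at height `t` is tiled by the bottom faces of cubes
that are narrower than it: higher cubes wall it in. -/
def IsValley (a : K → Fin (d + 1) → ℝ) (s : K → ℝ) (t : ℝ) (l u : Fin d → ℝ) : Prop :=
  ∀ γ ∈ germBox l u, ∃ w, StandsOn a s t l u w ∧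
    γ ∈ germBox (Fin.tail (a w)) fun j => Fin.tail (a w) j + s w

/-- The top face of the cube `c` is a valley. -/
def HasValleyOnTop (a : K → Fin (d + 1) → ℝ) (s : K → ℝ) (c : K) : Prop :=
  IsValley a s (a c 0 + s c) (Fin.tail (a c)) fun j => Fin.tail (a c) j + s c

variable {p q : Fin (d + 1) → ℝ} {a : K → Fin (d + 1) → ℝ} {s : K → ℝ} {t : ℝ} {l u : Fin d → ℝ}

theorem cons_mem_cube {w : K} {g : Germ} {γ : Fin d → Germ} :
    (Fin.cons g γ : Fin (d + 1) → Germ) ∈ germBox (a w) (fun j => a w j + s w) ↔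
      g ∈ germInterval (a w 0) (a w 0 + s w) ∧
        γ ∈ germBox (Fin.tail (a w)) fun j => Fin.tail (a w) j + s w :=
  cons_mem_germBox

theorem StandsOn.rightGerm_mem {w : K} (hw : StandsOn a s t l u w) {r : ℝ} (hr : 0 ≤ r)
    (hrs : r < s w) : rightGerm (t + r) ∈ germInterval (a w 0) (a w 0 + s w) :=
  rightGerm_mem_germInterval.2 ⟨hw.1 ▸ le_add_of_nonneg_right hr, hw.1 ▸ add_lt_add_right hrs t⟩

namespace IsCubing

theorem isValley_bottom (H : IsCubing p q a s) (hlt : ∀ w j, s w < q j - p j) (h0 : p 0 < q 0) :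
    IsValley a s (p 0) (Fin.tail p) (Fin.tail q) := by
  intro γ hγ
  obtain ⟨w, hw, -⟩ := H.existsUnique (Fin.cons (rightGerm (p 0)) γ)
    (cons_mem_germBox.2 ⟨rightGerm_mem_germInterval.2 ⟨le_rfl, h0⟩, hγ⟩)
  rw [cons_mem_cube] at hw
  exact ⟨w, ⟨le_antisymm (rightGerm_mem_germInterval.1 hw.1).1 (H.le_corner w 0),
    fun j => ⟨H.le_corner w _, H.corner_add_le w _, hlt w _⟩⟩, hw.2⟩

theorem isCubing_floor (H : IsCubing p q a s) (hV : IsValley a s t l u) :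
    IsCubing l u (fun w : {w // StandsOn a s t l u w} => Fin.tail (a w)) (fun w => s w) where
  side_pos w := H.side_pos w
  le_corner w j := (w.2.2 j).1
  corner_add_le w j := (w.2.2 j).2.1
  existsUnique γ hγ := by
    obtain ⟨w, hw, hγw⟩ := hV γ hγ
    refine ⟨⟨w, hw⟩, hγw, fun w' hγw' => Subtype.ext ?_⟩
    have mem_bottom (v : K) (hv : StandsOn a s t l u v) := hv.rightGerm_mem le_rfl (H.side_pos v)
    exact H.eq_of_mem (cons_mem_cube.2 ⟨mem_bottom w' w'.2, hγw'⟩)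
      (cons_mem_cube.2 ⟨mem_bottom w hw, hγw⟩)

/- A cube `v` above `c` which overhung a wall of the pit over `c` would meet the larger cube that
bounds the pit there. -/
theorem germInterval_subset_of_above (H : IsCubing p q a s) [Nontrivial (Fin d)]
    (hV : IsValley a s t l u) {c v : K} (hc : StandsOn a s t l u c)
    (hmin : ∀ w, StandsOn a s t l u w → w ≠ c → s c < s w) {γ : Fin d → Germ}
    (hγ : γ ∈ germBox (Fin.tail (a c)) fun j => Fin.tail (a c) j + s c)
    (hv : (Fin.cons (rightGerm (t + s c)) γ : Fin (d + 1) → Germ) ∈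
      germBox (a v) fun j => a v j + s v) (j : Fin d) :
    germInterval (a v j.succ) (a v j.succ + s v) ⊆
      germInterval (a c j.succ) (a c j.succ + s c) := by
  have hfloor := H.isCubing_floor hV
  let c' : {w // StandsOn a s t l u w} := ⟨c, hc⟩
  have smallest : ∀ w ≠ c', s c' < s w := fun w hw => hmin w w.2 (Subtype.coe_ne_coe.2 hw)
  have narrow : ∀ j, s c' < u j - l j := fun j => (hc.2 j).2.2
  rw [cons_mem_cube] at hv
  refine germInterval_subset_of_inter_subset (hfloor.lt_corner_of_smallest smallest narrow j)
    (lt_add_of_pos_right _ (H.side_pos c))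
    (hfloor.corner_add_lt_of_smallest smallest narrow j)
    ⟨γ j, hv.2 j trivial, hγ j trivial⟩ fun g hg => ?_
  by_contra hgc
  obtain ⟨w, hw, -⟩ := hfloor.existsUnique _
    (update_mem_germBox (hfloor.mem_of_mem (w := c') hγ) hg.2)
  have hwc : w ≠ c' := by
    rintro rfl
    exact hgc (by simpa [c', Fin.tail] using hw j trivial)
  have pit_wall := w.2.rightGerm_mem (H.side_pos c).le (smallest w hwc)
  obtain rfl : v = w := H.eq_of_mem
    (cons_mem_cube.2 ⟨hv.1, update_mem_germBox hv.2 hg.1⟩) (cons_mem_cube.2 ⟨pit_wall, hw⟩)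
  exact hwc (hfloor.eq_of_mem hv.2 hγ)

theorem add_side_lt_of_smallest (H : IsCubing p q a s) [Nontrivial (Fin d)]
    (hV : IsValley a s t l u) {c : K} (hc : StandsOn a s t l u c)
    (hmin : ∀ w, StandsOn a s t l u w → w ≠ c → s c < s w) : t + s c < q 0 := by
  have hfloor := H.isCubing_floor hV
  let c' : {w // StandsOn a s t l u w} := ⟨c, hc⟩
  obtain ⟨j⟩ : Nonempty (Fin d) := inferInstance
  have lt_corner := hfloor.lt_corner_of_smallest (c := c')
    (fun w hw => hmin w w.2 (Subtype.coe_ne_coe.2 hw)) (fun j => (hc.2 j).2.2) j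
  have left_mem : leftGerm (a c j.succ) ∈ germInterval (l j) (u j) :=
    leftGerm_mem_germInterval.2
      ⟨lt_corner, by linarith [H.side_pos c, (hc.2 j).2.1]⟩
  obtain ⟨w, hw, -⟩ := hfloor.existsUnique _
    (update_mem_germBox (hfloor.mem_of_mem (hfloor.rightGerm_mem c')) left_mem)
  have hwc : w ≠ c' := by
    rintro rfl
    have : leftGerm (a c j.succ) ∈ germInterval (a c j.succ) (a c j.succ + s c) := by
      simpa [c', Fin.tail] using hw j trivial
    exact (leftGerm_mem_germInterval.1 this).1.false
  linarith [hmin w w.2 (Subtype.coe_ne_coe.2 hwc), H.corner_add_le w 0, w.2.1]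

theorem hasValleyOnTop_of_smallest (H : IsCubing p q a s) [Nontrivial (Fin d)]
    (hs : Function.Injective s) (hV : IsValley a s t l u) {c : K} (hc : StandsOn a s t l u c)
    (hmin : ∀ w, StandsOn a s t l u w → w ≠ c → s c < s w) : HasValleyOnTop a s c := by
  intro γ hγ
  rw [hc.1]
  have top_mem : rightGerm (t + s c) ∈ germInterval (p 0) (q 0) :=
    rightGerm_mem_germInterval.2 ⟨by linarith [H.le_corner c 0, hc.1, H.side_pos c],
      H.add_side_lt_of_smallest hV hc hmin⟩
  have bottom_mem := hc.rightGerm_mem le_rfl (H.side_pos c)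
  have hγ_box := (cons_mem_germBox.1 (H.mem_of_mem (cons_mem_cube.2 ⟨bottom_mem, hγ⟩))).2
  obtain ⟨v, hv, -⟩ := H.existsUnique _ (cons_mem_germBox.2 ⟨top_mem, hγ_box⟩)
  have hsub := H.germInterval_subset_of_above hV hc hmin hγ hv
  rw [cons_mem_cube] at hv
  have hv_top := rightGerm_mem_germInterval.1 hv.1
  have hvc : v ≠ c := by
    rintro rfl
    linarith [hc.1]
  have bounds (j : Fin d) := (germInterval_subset_germInterval
    (lt_add_of_pos_right (a v j.succ) (H.side_pos v))).1 (hsub j)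
  have side_lt : s v < s c := by
    obtain ⟨j⟩ : Nonempty (Fin d) := inferInstance
    exact lt_of_le_of_ne (by linarith [(bounds j).1, (bounds j).2]) (hs.ne hvc)
  have corner_eq : a v 0 = t + s c := by
    refine hv_top.1.antisymm (not_lt.1 fun hlt => hvc ?_)
    have left_mem_v : leftGerm (t + s c) ∈ germInterval (a v 0) (a v 0 + s v) :=
      leftGerm_mem_germInterval.2 ⟨hlt, hv_top.2.le⟩
    have left_mem_c : leftGerm (t + s c) ∈ germInterval (a c 0) (a c 0 + s c) :=
      leftGerm_mem_germInterval.2 ⟨by linarith [hc.1, H.side_pos c], by rw [hc.1]⟩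
    exact H.eq_of_mem (cons_mem_cube.2 ⟨left_mem_v, hv.2⟩) (cons_mem_cube.2 ⟨left_mem_c, hγ⟩)
  exact ⟨v, ⟨corner_eq, fun j => ⟨(bounds j).1, (bounds j).2, by simpa using side_lt⟩⟩, hv.2⟩

theorem exists_hasValleyOnTop [Finite K] (H : IsCubing p q a s) [Nontrivial (Fin d)]
    (hs : Function.Injective s) (hV : IsValley a s t l u) (hlu : ∀ j, l j < u j) :
    ∃ c, StandsOn a s t l u c ∧ HasValleyOnTop a s c := by
  have := (H.isCubing_floor hV).nonempty hlu
  obtain ⟨c, hc⟩ := Finite.exists_min fun w : {w // StandsOn a s t l u w} => s w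
  exact ⟨c, c.2, H.hasValleyOnTop_of_smallest hs hV c.2 fun w hw hwc =>
    lt_of_le_of_ne (hc ⟨w, hw⟩) (hs.ne hwc.symm)⟩

theorem not_injective_side [Finite K] (H : IsCubing p q a s) [Nontrivial (Fin d)]
    (hpq : ∀ j, p j < q j) (hlt : ∀ w j, s w < q j - p j) : ¬ Function.Injective s := by
  intro hs
  obtain ⟨c₀, -, hc₀⟩ := H.exists_hasValleyOnTop hs (H.isValley_bottom hlt (hpq 0))
    fun j => hpq j.succ
  obtain ⟨c, hc, hmin⟩ := Set.exists_min_image {c | HasValleyOnTop a s c} s (Set.toFinite _)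
    ⟨c₀, hc₀⟩
  obtain ⟨c', hstands, hc'⟩ := H.exists_hasValleyOnTop hs hc
    fun j => lt_add_of_pos_right _ (H.side_pos c)
  obtain ⟨j⟩ : Nonempty (Fin d) := inferInstance
  have side_lt : s c' < s c := by simpa using (hstands.2 j).2.2
  exact (hmin c' hc').not_gt side_lt

end IsCubing

end Valley

/-- The point at distance `ε` from the base points of the germs in `γ`, on the side of each germ. -/
def germSample {ι : Type*} (γ : ι → Germ) (ε : ℝ) (j : ι) : ℝ :=
  (ofLex (γ j)).1 + if (ofLex (γ j)).2 then ε else -ε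

section Sampling

open Filter Topology

variable {ι : Type*} {γ : ι → Germ} {j : ι} {a b : ℝ}

theorem germ_cases (g : Germ) : (∃ x, g = rightGerm x) ∨ ∃ x, g = leftGerm x :=
  match g with
  | (x, true) => .inl ⟨x, rfl⟩
  | (x, false) => .inr ⟨x, rfl⟩

theorem germSample_of_eq_rightGerm {x : ℝ} (h : γ j = rightGerm x) (ε : ℝ) :
    germSample γ ε j = x + ε := by
  simp [germSample, h, rightGerm]

theorem germSample_of_eq_leftGerm {x : ℝ} (h : γ j = leftGerm x) (ε : ℝ) :
    germSample γ ε j = x - ε := by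
  simp [germSample, h, leftGerm, sub_eq_add_neg]

theorem eventually_germSample_mem_Icc (h : γ j ∈ germInterval a b) :
    ∀ᶠ ε in 𝓝[>] 0, germSample γ ε j ∈ Set.Icc a b := by
  rcases germ_cases (γ j) with ⟨x, hx⟩ | ⟨x, hx⟩
  · rw [hx, rightGerm_mem_germInterval] at h
    filter_upwards [Ioo_mem_nhdsGT (sub_pos.2 h.2)] with ε hε
    rw [germSample_of_eq_rightGerm hx]
    constructor <;> linarith [hε.1, hε.2]
  · rw [hx, leftGerm_mem_germInterval] at h
    filter_upwards [Ioo_mem_nhdsGT (sub_pos.2 h.1)] with ε hε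
    rw [germSample_of_eq_leftGerm hx]
    constructor <;> linarith [hε.1, hε.2]

theorem eventually_germSample_notMem_Icc (h : γ j ∉ germInterval a b) :
    ∀ᶠ ε in 𝓝[>] 0, germSample γ ε j ∉ Set.Icc a b := by
  rcases germ_cases (γ j) with ⟨x, hx⟩ | ⟨x, hx⟩
  · rw [hx, rightGerm_mem_germInterval, not_and_or, not_le, not_lt] at h
    rcases h with h | h
    · filter_upwards [Ioo_mem_nhdsGT (sub_pos.2 h)] with ε hε
      rw [germSample_of_eq_rightGerm hx]
      exact fun hmem => by linarith [hmem.1, hε.2]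
    · filter_upwards [self_mem_nhdsWithin] with ε hε
      rw [germSample_of_eq_rightGerm hx]
      exact fun hmem => by linarith [hmem.2, Set.mem_Ioi.1 hε]
  · rw [hx, leftGerm_mem_germInterval, not_and_or, not_lt, not_le] at h
    rcases h with h | h
    · filter_upwards [self_mem_nhdsWithin] with ε hε
      rw [germSample_of_eq_leftGerm hx]
      exact fun hmem => by linarith [hmem.1, Set.mem_Ioi.1 hε]
    · filter_upwards [Ioo_mem_nhdsGT (sub_pos.2 h)] with ε hε
      rw [germSample_of_eq_leftGerm hx]
      exact fun hmem => by linarith [hmem.2, hε.2]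

theorem exists_mem_germBox_of_cover {K : Type*} [Finite ι] [Finite K] {p q : ι → ℝ}
    {a b : K → ι → ℝ} (hcover : Set.Icc p q ⊆ ⋃ w, Set.Icc (a w) (b w)) (hγ : γ ∈ germBox p q) :
    ∃ w, γ ∈ germBox (a w) (b w) := by
  by_contra! hno
  have sample_mem : ∀ᶠ ε in 𝓝[>] 0, ∀ j, germSample γ ε j ∈ Set.Icc (p j) (q j) :=
    eventually_all.2 fun j => eventually_germSample_mem_Icc (hγ j trivial)
  have sample_notMem : ∀ᶠ ε in 𝓝[>] 0, ∀ w, germSample γ ε ∉ Set.Icc (a w) (b w) := by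
    refine eventually_all.2 fun w => ?_
    obtain ⟨j, hj⟩ : ∃ j, γ j ∉ germInterval (a w j) (b w j) := by
      simpa [germBox, Set.mem_pi] using hno w
    exact (eventually_germSample_notMem_Icc hj).mono fun ε hε hmem => hε ⟨hmem.1 j, hmem.2 j⟩
  obtain ⟨ε, hε, hε'⟩ := (sample_mem.and sample_notMem).exists
  obtain ⟨w, hw⟩ := Set.mem_iUnion.1 (hcover ⟨fun j => (hε j).1, fun j => (hε j).2⟩)
  exact hε' w hw

end Sampling

theorem CubeTiling.isCubing {V : Type*} [Finite V] {n : ℕ} [NeZero n] {T : DiscreteBox V n}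
    {h : Fin n → ℝ} (C : CubeTiling T h) :
    IsCubing 0 h (fun v : {v // 0 < C.side v} => C.corner v) (fun v => C.side v) where
  side_pos v := v.2
  le_corner v := C.corner_nonneg v
  corner_add_le v := C.corner_add_le v
  existsUnique γ hγ := by
    obtain ⟨v, hv⟩ := exists_mem_germBox_of_cover C.cover.ge hγ
    have side_pos : 0 < C.side v := NNReal.coe_pos.1 <|
      (lt_add_iff_pos_right _).1 (lt_of_mem_germInterval (hv 0 trivial) (hv 0 trivial))
    refine ⟨⟨v, side_pos⟩, hv, fun w hw => Subtype.ext ?_⟩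
    by_contra hne
    obtain ⟨j, hj | hj⟩ := C.packing.separated w v hne w.2 side_pos
    · exact (lt_of_mem_germInterval (hv j trivial) (hw j trivial)).not_ge hj
    · exact (lt_of_mem_germInterval (hw j trivial) (hv j trivial)).not_ge hj

namespace CubePacking

theorem eq_of_le_side_of_mem_shadow {V : Type*} {n : ℕ} {T : DiscreteBox V (n + 1)}
    {h : Fin (n + 1) → ℝ} (P : CubePacking T h) {j : Fin (n + 1)} {u v : T.Vertex}
    (hv : h j ≤ P.side v) (hu_pos : 0 < P.side u) {y : Fin n → ℝ}
    (hyv : y ∈ interior (P.shadow j v)) (hyu : y ∈ P.shadow j u) : u = v := by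
  by_contra hne
  rw [shadow, interior_axisCube] at hyv
  have side_v_pos : 0 < P.side v := NNReal.coe_pos.1 <| by
    linarith [P.corner_nonneg u j, P.corner_add_le u j, NNReal.coe_pos.2 hu_pos]
  obtain ⟨i, hi⟩ := P.separated u v hne hu_pos side_v_pos
  rcases Fin.eq_self_or_eq_succAbove j i with rfl | ⟨i, rfl⟩
  · rcases hi with hi | hi <;>
      linarith [P.corner_nonneg u i, P.corner_add_le u i, P.corner_nonneg v i,
        P.corner_add_le v i, NNReal.coe_pos.2 hu_pos]
  · rcases hi with hi | hi
    · exact ((hyv i trivial).1.trans_le (hyu.2 i)).not_ge hi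
    · exact ((hyu.1 i).trans_lt (hyv i trivial).2).not_ge hi

/- The vertex path over a generic point `y` below the cube of `v` could only consist of `v`. -/
theorem side_lt {V : Type*} [Finite V] {n : ℕ} {T : DiscreteBox V (n + 2)}
    {h : Fin (n + 2) → ℝ} (P : CubePacking T h) (hpos : ∀ i, 0 < h i) (v : T.Vertex)
    (j : Fin (n + 2)) : (P.side v : ℝ) < h j := by
  by_contra! hle
  have side_pos : (0 : ℝ) < P.side v := (hpos j).trans_le hle
  obtain ⟨y₀, hy₀⟩ : (interior (P.shadow j v)).Nonempty := by
    rw [shadow, interior_axisCube, Set.univ_pi_nonempty_iff]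
    exact fun i => Set.nonempty_Ioo.2 (lt_add_of_pos_right _ side_pos)
  obtain ⟨y, hy, hy_corner⟩ := ((infinite_of_mem_nhds y₀ (isOpen_interior.mem_nhds hy₀)).sdiff
    (Set.finite_range fun w => j.removeNth (P.corner w))).nonempty
  have only_v : ∀ u, y ∈ P.shadow j u → u = v := fun u hu => by
    refine P.eq_of_le_side_of_mem_shadow hle (pos_iff_ne_zero.2 fun h0 => hy_corner ⟨u, ?_⟩) hy hu
    simpa [shadow, axisCube, h0, eq_comm] using hu
  have hy_mem := interior_subset hy
  obtain ⟨a, b, ha, hb, γ, hγ⟩ := P.exists_path_of_line j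
    ⟨fun i => (P.corner_nonneg v _).trans (hy_mem.1 i),
      fun i => (hy_mem.2 i).trans (P.corner_add_le v _)⟩
  obtain rfl := only_v a (hγ a γ.1.start_mem_support)
  obtain rfl := only_v b (hγ b γ.1.end_mem_support)
  exact T.notMem_B'_of_mem_B ha hb

end CubePacking

theorem CubeTiling.exists_side_eq {V : Type*} [Finite V] {n : ℕ} {T : DiscreteBox V (n + 3)}
    {h : Fin (n + 3) → ℝ} (C : CubeTiling T h) (hpos : ∀ i, 0 < h i) :
    ∃ v w, v ≠ w ∧ C.side v = C.side w ∧ 0 < C.side v := by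
  obtain ⟨v, w, hside, hne⟩ := Function.not_injective_iff.1 <|
    C.isCubing.not_injective_side hpos fun v j =>
      (C.packing.side_lt hpos v j).trans_eq (sub_zero _).symm
  exact ⟨v, w, Subtype.coe_ne_coe.2 hne, NNReal.coe_injective hside, v.2⟩

theorem mainTheorem3_general {V : Type*} [Finite V] (n : ℕ) (T : DiscreteBox V (n + 3))
    (m : T.Vertex → ℝ≥0) (hm : T.IsExtremal m)
    (h : Fin (n + 3) → ℝ) (hpos : ∀ i, 0 < h i) (C : CubeTiling T h) :
    (∀ (i : Fin (n + 3)) (τ : Equiv.Perm (Fin (n + 2))),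
      ((T.face i).permute τ).EL = ((T.face' i).permute τ).EL) ∧
    (∀ σ : Fin (n + 3) → Equiv.Perm (Fin (n + 3)), (∀ i, σ i 0 = i) →
      ∏ i, (T.permute (σ i)).EL = 1) ∧
    (∃ v w : T.Vertex, v ≠ w ∧ m v = m w ∧ 0 < m v) := by
  refine ⟨C.packing.EL_permute_face_eq hpos, C.packing.prod_EL_permute hpos, ?_⟩
  obtain ⟨v, w, hvw, side_eq, side_pos⟩ := C.exists_side_eq hpos
  exact ⟨v, w, hvw, C.packing.eq_of_side_eq_of_isExtremal hpos (by lia) hm side_eq,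
    C.packing.pos_of_side_pos_of_isExtremal hpos (by lia) hm side_pos⟩

theorem mainTheorem3 {V : Type*} [Finite V] (n : ℕ) (T : DiscreteBox V (n + 3))
    (m : T.Vertex → ℝ≥0) (hm : T.IsExtremal m)
    (h : Fin (n + 3) → ℝ) (hpos : ∀ i, 0 < h i) (hvol : ∏ i, h i = 1)
    (C : CubeTiling T h) :
    (∀ (i : Fin (n + 3)) (τ : Equiv.Perm (Fin (n + 2))),
      ((T.face i).permute τ).EL = ((T.face' i).permute τ).EL) ∧
    (∀ σ : Fin (n + 3) → Equiv.Perm (Fin (n + 3)), (∀ i, σ i 0 = i) →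
      ∏ i, (T.permute (σ i)).EL = 1) ∧
    (∃ v w : T.Vertex, v ≠ w ∧ m v = m w ∧ 0 < m v) :=
  mainTheorem3_general n T m hm h hpos C
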